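/- Consider formulas of monadic second-order logic (MSO) with equality, with individual variables and set variables, in a vocabulary whose only function symbol is one unary function symbol $f$ and whose relation symbols, other than equality, are unary relation symbols from a countably infinite list $P_0,P_1,P_2,\dots$. The set quantifiers range over all subsets of the universe. Call such a formula $\varphi$ \emph{finitely satisfiable} if there are a nonempty finite set $A$, a function $f\colon A\to A$, subsets $P_0,P_1,\dots$ of $A$, and an assignment of elements of $A$ to the individual variables and of subsets of $A$ to the set variables, under which $\varphi$ is true (if $\varphi$ is a sentence, this says that $\varphi$ has a finite model). \textbf{Theorem.} The finite satisfiability problem for MSO formulas with one unary function symbol is decidable: there is an algorithm that, given such a formula $\varphi$, decides whether $\varphi$ is finitely satisfiable. -/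

import Mathlib

namespace MSOUnary

/-- Terms over one unary function symbol `f`: individual variables `x₀, x₁, …` and `f(t)`. -/
inductive Term : Type
  | var (i : ℕ) : Term
  | app (t : Term) : Term

/-- Formulas of monadic second-order logic whose only function symbol is the unary symbol `f` and
whose relation symbols other than equality are the unary symbols `P₀, P₁, …`. There are individual
variables `x₀, x₁, …` and set variables `X₀, X₁, …`. The other connectives and quantifiers are the
usual abbreviations, given below. -/
inductive Formula : Type
  /-- `s = t` -/
  | eq (s t : Term) : Formula
  /-- `Pᵢ(t)` -/
  | rel (i : ℕ) (t : Term) : Formula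
  /-- `t ∈ Xᵢ` -/
  | mem (t : Term) (i : ℕ) : Formula
  /-- `¬ φ` -/
  | neg (φ : Formula) : Formula
  /-- `φ ∧ ψ` -/
  | conj (φ ψ : Formula) : Formula
  /-- `∃ xᵢ, φ` -/
  | ex (i : ℕ) (φ : Formula) : Formula
  /-- `∃ Xᵢ, φ` -/
  | exSet (i : ℕ) (φ : Formula) : Formula

namespace Formula

/-- `φ ∨ ψ` -/
def disj (φ ψ : Formula) : Formula := neg (conj (neg φ) (neg ψ))

/-- `φ → ψ` -/
def imp (φ ψ : Formula) : Formula := neg (conj φ (neg ψ))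

/-- `∀ xᵢ, φ` -/
def all (i : ℕ) (φ : Formula) : Formula := neg (ex i (neg φ))

/-- `∀ Xᵢ, φ` -/
def allSet (i : ℕ) (φ : Formula) : Formula := neg (exSet i (neg φ))

end Formula

/-- An interpretation on the universe `A` of the function symbol `f` and the unary relation
symbols `Pᵢ`. -/
structure Interp (A : Type) where
  fn : A → A
  rel : ℕ → Set A

/-- The value of a term under an assignment `v` of the individual variables. -/
def Term.eval {A : Type} (M : Interp A) (v : ℕ → A) : Term → A
  | var i => v i
  | app t => M.fn (t.eval M v)

/-- Satisfaction `M ⊨ φ` under assignments `v` of the individual variables and `V` of the set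
variables; set quantifiers range over all subsets of the universe. -/
def Formula.Sat {A : Type} (M : Interp A) : (ℕ → A) → (ℕ → Set A) → Formula → Prop
  | v, _, eq s t => s.eval M v = t.eval M v
  | v, _, rel i t => t.eval M v ∈ M.rel i
  | v, V, mem t i => t.eval M v ∈ V i
  | v, V, neg φ => ¬ Sat M v V φ
  | v, V, conj φ ψ => Sat M v V φ ∧ Sat M v V ψ
  | v, V, ex i φ => ∃ a : A, Sat M (Function.update v i a) V φ
  | v, V, exSet i φ => ∃ S : Set A, Sat M v (Function.update V i S) φ

/-- `φ` has a finite (nonempty) model; for a formula with free variables this means that it holds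
in some finite structure under some assignment of its variables. -/
def Formula.FinitelySatisfiable (φ : Formula) : Prop :=
  ∃ (A : Type) (_ : Finite A) (_ : Nonempty A) (M : Interp A) (v : ℕ → A) (V : ℕ → Set A),
    φ.Sat M v V

/-! ### Gödel numbering: terms and formulas as inputs of algorithms -/

namespace Term

/-- The number of the term `f(f(…f(xᵢ)…))` with `k` occurrences of `f` is `Nat.pair i k`. -/
def code : Term → ℕ
  | var i => Nat.pair i 0
  | app t => Nat.pair t.code.unpair.1 (t.code.unpair.2 + 1)

/-- The term `f(f(…f(xᵢ)…))` with `k` occurrences of `f`. -/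
def iter (i : ℕ) : ℕ → Term
  | 0 => var i
  | k + 1 => app (iter i k)

def decode (n : ℕ) : Term := iter n.unpair.1 n.unpair.2

theorem code_iter (i k : ℕ) : (iter i k).code = Nat.pair i k := by
  induction k with
  | zero => rfl
  | succ k ih => simp [iter, code, ih]

theorem decode_code (t : Term) : decode t.code = t := by
  induction t with
  | var i => simp [decode, code, iter]
  | app t ih =>
    simp only [decode] at ih
    simp [decode, code, iter, ih]

theorem code_decode (n : ℕ) : (decode n).code = n := by
  simp [decode, code_iter]

instance : Denumerable Term :=
  Denumerable.mk' ⟨code, decode, decode_code, code_decode⟩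

end Term

namespace Formula

/-- The Gödel number of a formula. -/
def code : Formula → ℕ
  | eq s t => 7 * Nat.pair s.code t.code
  | rel i t => 7 * Nat.pair i t.code + 1
  | mem t i => 7 * Nat.pair t.code i + 2
  | neg φ => 7 * φ.code + 3
  | conj φ ψ => 7 * Nat.pair φ.code ψ.code + 4
  | ex i φ => 7 * Nat.pair i φ.code + 5
  | exSet i φ => 7 * Nat.pair i φ.code + 6

/-- The formula with a given Gödel number. -/
def decode (n : ℕ) : Formula :=
  if n % 7 = 0 then eq (Term.decode (n / 7).unpair.1) (Term.decode (n / 7).unpair.2)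
  else if n % 7 = 1 then rel (n / 7).unpair.1 (Term.decode (n / 7).unpair.2)
  else if n % 7 = 2 then mem (Term.decode (n / 7).unpair.1) (n / 7).unpair.2
  else if n % 7 = 3 then neg (decode (n / 7))
  else if n % 7 = 4 then conj (decode (n / 7).unpair.1) (decode (n / 7).unpair.2)
  else if n % 7 = 5 then ex (n / 7).unpair.1 (decode (n / 7).unpair.2)
  else exSet (n / 7).unpair.1 (decode (n / 7).unpair.2)
termination_by n
decreasing_by
  all_goals
    have h₁ := Nat.unpair_left_le (n / 7)
    have h₂ := Nat.unpair_right_le (n / 7)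
    omega

theorem decode_code (φ : Formula) : decode φ.code = φ := by
  induction φ with
  | eq s t =>
    rw [decode]; simp [code, Term.decode_code]
  | rel i t =>
    have h₁ : (7 * Nat.pair i t.code + 1) / 7 = Nat.pair i t.code := by omega
    rw [decode]; simp [code, Nat.add_mod, h₁, Term.decode_code]
  | mem t i =>
    have h₁ : (7 * Nat.pair t.code i + 2) / 7 = Nat.pair t.code i := by omega
    rw [decode]; simp [code, Nat.add_mod, h₁, Term.decode_code]
  | neg φ ih =>
    have h₁ : (7 * φ.code + 3) / 7 = φ.code := by omega
    rw [decode]; simp [code, Nat.add_mod, h₁, ih]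
  | conj φ ψ ih₁ ih₂ =>
    have h₁ : (7 * Nat.pair φ.code ψ.code + 4) / 7 = Nat.pair φ.code ψ.code := by omega
    rw [decode]; simp [code, Nat.add_mod, h₁, ih₁, ih₂]
  | ex i φ ih =>
    have h₁ : (7 * Nat.pair i φ.code + 5) / 7 = Nat.pair i φ.code := by omega
    rw [decode]; simp [code, Nat.add_mod, h₁, ih]
  | exSet i φ ih =>
    have h₁ : (7 * Nat.pair i φ.code + 6) / 7 = Nat.pair i φ.code := by omega
    rw [decode]; simp [code, Nat.add_mod, h₁, ih]

theorem code_decode (n : ℕ) : (decode n).code = n := by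
  induction n using Nat.strong_induction_on with
  | _ n ih =>
    have h₁ := Nat.unpair_left_le (n / 7)
    have h₂ := Nat.unpair_right_le (n / 7)
    rw [decode]
    split_ifs
    · simp only [code, Term.code_decode, Nat.pair_unpair]; omega
    · simp only [code, Term.code_decode, Nat.pair_unpair]; omega
    · simp only [code, Term.code_decode, Nat.pair_unpair]; omega
    · simp only [code]; rw [ih _ (by omega)]; omega
    · simp only [code]; rw [ih _ (by omega), ih _ (by omega), Nat.pair_unpair]; omega
    · simp only [code]; rw [ih _ (by omega), Nat.pair_unpair]; omega
    · simp only [code]; rw [ih _ (by omega), Nat.pair_unpair]; omega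

/-- Formulas are coded by their Gödel numbers; this fixes what it means that a predicate of
formulas is computable. -/
instance : Denumerable Formula :=
  Denumerable.mk' ⟨code, decode, decode_code, code_decode⟩

end Formula

end MSOUnary

/-!
A formula that has a finite model has one whose size is bounded by an explicit primitive recursive
function of its Gödel number, and whether it has a model of a given finite size can be decided by
exhaustive search.

The small model property is a composition argument. The graph of a unary function is generalised
to a partial function (`PGraph`) whose undefined points are *exits*, together with at most one
*entry* point. Two such graphs can be glued (`glue`): the exits of one are connected to the entry
of the other (or of the same) graph, or left alone. For coloured graphs there are only finitely
many Hintikka types `tp` of each rank, at most `typeBound` many, and the type of a gluing depends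
only on the types of its parts (`tp_glue_congr`). Every finite graph that is acyclic or has no
entry point can be built from points by gluing (`gen_of_good`): if `r` is a point reached by as
many points as possible, then either the points that reach `r` and the others form two parts with
no edge between them, or everything reaches `r`. In the second case the graph minus `r` is
acyclic, and its exits are exactly the points mapped to `r`. If `r` lies on a cycle, its image
becomes the entry point of the rest; otherwise the graph is acyclic, and the rest can keep the
original entry point. If `s(t)` is the least size of a graph of type `t` built in this way, then a
smallest graph of type `t` is a point or is glued from graphs of smaller sizes `s(t₁)` and
`s(t₂)`. So, when the types are sorted by `s`, each value other than `1` is at most twice an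
earlier one, and `s` is at most exponential in the number of types (`Gen.exists_small`).

An interpretation with assignments is described by a colouring of its graph: set variables and
relation symbols are colours, and each of the relevant terms `f^k(xᵢ)` is a singleton colour. The
type of this colouring determines which formulas hold (`sat_iff_of_tp_eq`), and every
coloured graph of the same type comes from an interpretation, whence
`Formula.FinitelySatisfiable.exists_small_model`.

For the search, an interpretation on `{0, …, n}` together with its assignments is one number, read
in base `2 ^ (n + 1)`. The list `tab n L k` of the codes that satisfy the formula with Gödel
number `k` is primitive recursive by course-of-values recursion on `k` (`primrec_tab`); a
quantifier becomes a search for a code in the list of the subformula that differs in one digit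
only.
-/

namespace MSOUnary

/-! ### Types of coloured graphs -/

/-- A partial unary function on `carrier`, with at most one distinguished *entry* point. The points
where the function is undefined are its *exits*: they wait to be connected to an entry point. -/
structure PGraph where
  carrier : Type
  fn : carrier → Option carrier
  entry : Option carrier

/-- The atomic properties of a graph with colour classes `S i` that types record. -/
inductive Atom (ι : Type) : Type
  /-- `S i ∩ S j` is nonempty. -/
  | meets (i j : ι)
  /-- `S i` has at least two elements. -/
  | many (i : ι)
  /-- Some point of `S i` is mapped to a point of `S j`. -/
  | edge (i j : ι)
  /-- Some point of `S i` is an exit. -/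
  | exit (i : ι)
  /-- The entry point exists and lies in `S i`. -/
  | entry (i : ι)
  /-- There is an exit. -/
  | hasExit
  /-- There is an entry point. -/
  | hasEntry

/-- Truth of an atomic property. -/
def Atom.Holds {ι : Type} (P : PGraph) (S : ι → Set P.carrier) : Atom ι → Prop
  | meets i j => ∃ x, x ∈ S i ∧ x ∈ S j
  | many i => ∃ x ∈ S i, ∃ y ∈ S i, x ≠ y
  | edge i j => ∃ x ∈ S i, ∃ y ∈ S j, P.fn x = some y
  | exit i => ∃ x ∈ S i, P.fn x = none
  | entry i => ∃ x ∈ S i, P.entry = some x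
  | hasExit => ∃ x, P.fn x = none
  | hasEntry => ∃ x, P.entry = some x

/-- Hintikka types of rank `q`. A type of rank `q + 1` consists of the atomic properties and, for
each block `J` of colours, the types of rank `q` that can be reached by recolouring `J`. -/
def Ty (ι : Type) : ℕ → Type
  | 0 => Set (Atom ι)
  | q + 1 => Set (Atom ι) × (Set ι → Set (Ty ι q))

/-- The type of rank `q` of a coloured graph. -/
def tp {ι : Type} (P : PGraph) : (q : ℕ) → (ι → Set P.carrier) → Ty ι q
  | 0, S => {a | a.Holds P S}
  | q + 1, S => ({a | a.Holds P S}, fun J => {t | ∃ X, (∀ i ∉ J, X i = S i) ∧ tp P q X = t})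

section types

variable {ι : Type} {P Q : PGraph} {S : ι → Set P.carrier} {T : ι → Set Q.carrier}

theorem holds_iff_of_tp_eq {q : ℕ} (h : tp P q S = tp Q q T) (a : Atom ι) :
    a.Holds P S ↔ a.Holds Q T := by
  cases q with
  | zero => exact Set.ext_iff.1 h a
  | succ q => exact Set.ext_iff.1 (congrArg Prod.fst h) a

theorem exists_tp_eq_of_tp_succ_eq {q : ℕ} (h : tp P (q + 1) S = tp Q (q + 1) T) (J : Set ι)
    (X : ι → Set P.carrier) (hX : ∀ i ∉ J, X i = S i) :
    ∃ Y : ι → Set Q.carrier, (∀ i ∉ J, Y i = T i) ∧ tp P q X = tp Q q Y := by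
  have h' := congrFun (congrArg Prod.snd h) J
  have : tp P q X ∈ {t | ∃ Y : ι → Set Q.carrier, (∀ i ∉ J, Y i = T i) ∧ tp Q q Y = t} :=
    (Set.ext_iff.1 h' _).1 ⟨X, hX, rfl⟩
  obtain ⟨Y, hY, e⟩ := this
  exact ⟨Y, hY, e.symm⟩

theorem tp_succ_eq {q : ℕ} (h₀ : ∀ a : Atom ι, a.Holds P S ↔ a.Holds Q T)
    (h₁ : ∀ (J : Set ι) X, (∀ i ∉ J, X i = S i) → ∃ Y : ι → Set Q.carrier,
      (∀ i ∉ J, Y i = T i) ∧ tp P q X = tp Q q Y)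
    (h₂ : ∀ (J : Set ι) Y, (∀ i ∉ J, Y i = T i) → ∃ X : ι → Set P.carrier,
      (∀ i ∉ J, X i = S i) ∧ tp P q X = tp Q q Y) :
    tp P (q + 1) S = tp Q (q + 1) T := by
  refine Prod.ext (Set.ext h₀) (funext fun J => Set.ext fun t => ⟨?_, ?_⟩)
  · rintro ⟨X, hX, rfl⟩
    obtain ⟨Y, hY, e⟩ := h₁ J X hX
    exact ⟨Y, hY, e.symm⟩
  · rintro ⟨Y, hY, rfl⟩
    exact h₂ J Y hY

end types

/-- An isomorphism of graphs: a bijection that respects the functions and the entry points. -/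
structure PIso (P Q : PGraph) where
  toEquiv : P.carrier ≃ Q.carrier
  fn_map : ∀ x, Q.fn (toEquiv x) = (P.fn x).map toEquiv
  entry_map : Q.entry = P.entry.map toEquiv

theorem PIso.holds_iff {ι : Type} {P Q : PGraph} (e : PIso P Q) (T : ι → Set Q.carrier)
    (a : Atom ι) : a.Holds P (fun i => e.toEquiv ⁻¹' T i) ↔ a.Holds Q T := by
  have h : ∀ p : Q.carrier → Prop, (∃ y, p y) ↔ ∃ x, p (e.toEquiv x) := fun p =>
    e.toEquiv.surjective.exists
  cases a <;> simp only [Atom.Holds, h, e.fn_map, e.entry_map, Set.mem_preimage] <;>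
    simp

theorem PIso.tp_eq {ι : Type} {P Q : PGraph} (e : PIso P Q) (q : ℕ) (T : ι → Set Q.carrier) :
    tp P q (fun i => e.toEquiv ⁻¹' T i) = tp Q q T := by
  induction q generalizing T with
  | zero => exact Set.ext (e.holds_iff T)
  | succ q ih =>
    refine tp_succ_eq (e.holds_iff T) (fun J X hX => ?_) fun J Y hY => ?_
    · refine ⟨fun i => e.toEquiv.symm ⁻¹' X i, fun i hi => ?_, ?_⟩
      · simp only [hX i hi, ← Set.preimage_comp]; simp
      · rw [← ih]
        congr 1
        funext i
        rw [← Set.preimage_comp]; simp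
    · exact ⟨fun i => e.toEquiv ⁻¹' Y i, fun i hi => by simp only [hY i hi], ih Y⟩

/-! ### Gluing -/

/-- The point designated by an instruction for gluing `B` and `C`: nothing, the entry point of `B`
(`some false`) or the entry point of `C` (`some true`). -/
def target (B C : PGraph) : Option Bool → Option (B.carrier ⊕ C.carrier)
  | none => none
  | some false => B.entry.map Sum.inl
  | some true => C.entry.map Sum.inr

/-- Instructions for gluing two graphs: where the exits of the left and of the right graph are sent,
and which point becomes the new entry point. -/
structure Gluing where
  left : Option Bool
  right : Option Bool
  entry : Option Bool

/-- The disjoint union of two graphs, with their exits connected as instructed. -/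
def glue (g : Gluing) (B C : PGraph) : PGraph where
  carrier := B.carrier ⊕ C.carrier
  fn := Sum.elim (fun b => ((B.fn b).map Sum.inl).or (target B C g.left))
    (fun c => ((C.fn c).map Sum.inr).or (target B C g.right))
  entry := target B C g.entry

/-- The colouring of a disjoint union. -/
def joinCol {ι α β : Type} (S : ι → Set α) (T : ι → Set β) (i : ι) : Set (α ⊕ β) :=
  {x | Sum.elim (· ∈ S i) (· ∈ T i) x}

section glue

variable {ι : Type} {B C B' C' : PGraph} {S : ι → Set B.carrier} {T : ι → Set C.carrier}
  {S' : ι → Set B'.carrier} {T' : ι → Set C'.carrier}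

@[simp]
theorem inl_mem_joinCol {α β : Type} {S : ι → Set α} {T : ι → Set β} {i : ι} {a : α} :
    (Sum.inl a : α ⊕ β) ∈ joinCol S T i ↔ a ∈ S i := Iff.rfl

@[simp]
theorem inr_mem_joinCol {α β : Type} {S : ι → Set α} {T : ι → Set β} {i : ι} {b : β} :
    (Sum.inr b : α ⊕ β) ∈ joinCol S T i ↔ b ∈ T i := Iff.rfl

theorem exists_glue (g : Gluing) (p : (glue g B C).carrier → Prop) :
    (∃ x, p x) ↔ (∃ b : B.carrier, p (Sum.inl b)) ∨ ∃ c : C.carrier, p (Sum.inr c) :=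
  Sum.exists

theorem glue_fn_inl_eq_some {g : Gluing} {b : B.carrier} {y : (glue g B C).carrier} :
    (glue g B C).fn (Sum.inl b) = some y ↔
      (∃ b', B.fn b = some b' ∧ Sum.inl b' = y) ∨ B.fn b = none ∧ target B C g.left = some y :=
  Option.or_eq_some_iff.trans
    (or_congr Option.map_eq_some_iff (and_congr_left' Option.map_eq_none_iff))

theorem glue_fn_inr_eq_some {g : Gluing} {c : C.carrier} {y : (glue g B C).carrier} :
    (glue g B C).fn (Sum.inr c) = some y ↔
      (∃ c', C.fn c = some c' ∧ Sum.inr c' = y) ∨ C.fn c = none ∧ target B C g.right = some y :=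
  Option.or_eq_some_iff.trans
    (or_congr Option.map_eq_some_iff (and_congr_left' Option.map_eq_none_iff))

theorem glue_fn_inl_eq_none {g : Gluing} {b : B.carrier} :
    (glue g B C).fn (Sum.inl b) = none ↔ B.fn b = none ∧ target B C g.left = none := by
  simp [glue]

theorem glue_fn_inr_eq_none {g : Gluing} {c : C.carrier} :
    (glue g B C).fn (Sum.inr c) = none ↔ C.fn c = none ∧ target B C g.right = none := by
  simp [glue]

theorem glue_fn_inl_of_eq_none (g : Gluing) {b : B.carrier} (h : B.fn b = none) :
    (glue g B C).fn (Sum.inl b) = target B C g.left := by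
  change ((B.fn b).map Sum.inl).or _ = _
  rw [h]
  rfl

theorem glue_fn_inr_of_eq_none (g : Gluing) {c : C.carrier} (h : C.fn c = none) :
    (glue g B C).fn (Sum.inr c) = target B C g.right := by
  change ((C.fn c).map Sum.inr).or _ = _
  rw [h]
  rfl

/-- The point designated by an instruction is an entry point, so that its colours are determined by
the atomic properties of the two parts. -/
theorem target_mem_congr (hB : ∀ a : Atom ι, a.Holds B S ↔ a.Holds B' S')
    (hC : ∀ a : Atom ι, a.Holds C T ↔ a.Holds C' T') (o : Option Bool) (i : ι) :
    (∃ x ∈ joinCol S T i, target B C o = some x) ↔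
      ∃ x ∈ joinCol S' T' i, target B' C' o = some x := by
  have h₁ := hB (.entry i)
  have h₂ := hC (.entry i)
  rcases o with _ | _ | _
  · simp [target]
  · simpa [target, Sum.exists, Atom.Holds] using h₁
  · simpa [target, Sum.exists, Atom.Holds] using h₂

theorem target_eq_none_congr (hB : ∀ a : Atom ι, a.Holds B S ↔ a.Holds B' S')
    (hC : ∀ a : Atom ι, a.Holds C T ↔ a.Holds C' T') (o : Option Bool) :
    target B C o = none ↔ target B' C' o = none := by
  have h₁ := not_congr (hB .hasEntry)
  have h₂ := not_congr (hC .hasEntry)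
  simp only [Atom.Holds, ← Option.ne_none_iff_exists', not_not] at h₁ h₂
  rcases o with _ | _ | _
  · simp [target]
  · simpa [target] using h₁
  · simpa [target] using h₂

theorem holds_glue_many (g : Gluing) (i : ι) :
    (Atom.many i).Holds (glue g B C) (joinCol S T) ↔ (Atom.many i).Holds B S ∨
      (Atom.many i).Holds C T ∨ (Atom.meets i i).Holds B S ∧ (Atom.meets i i).Holds C T := by
  constructor
  · rintro ⟨x | x, hx, y | y, hy, h⟩
    · exact .inl ⟨x, hx, y, hy, fun e => h (e ▸ rfl)⟩
    · exact .inr (.inr ⟨⟨x, hx, hx⟩, ⟨y, hy, hy⟩⟩)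
    · exact .inr (.inr ⟨⟨y, hy, hy⟩, ⟨x, hx, hx⟩⟩)
    · exact .inr (.inl ⟨x, hx, y, hy, fun e => h (e ▸ rfl)⟩)
  · rintro (⟨x, hx, y, hy, h⟩ | ⟨x, hx, y, hy, h⟩ | ⟨⟨x, hx, -⟩, ⟨y, hy, -⟩⟩)
    · exact ⟨.inl x, hx, .inl y, hy, fun e => h (Sum.inl_injective e)⟩
    · exact ⟨.inr x, hx, .inr y, hy, fun e => h (Sum.inr_injective e)⟩
    · exact ⟨.inl x, hx, .inr y, hy, Sum.inl_ne_inr⟩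

theorem holds_glue_edge (g : Gluing) (i j : ι) :
    (Atom.edge i j).Holds (glue g B C) (joinCol S T) ↔
      ((Atom.edge i j).Holds B S ∨ (Atom.edge i j).Holds C T) ∨
      ((Atom.exit i).Holds B S ∧ ∃ y ∈ joinCol S T j, target B C g.left = some y) ∨
      ((Atom.exit i).Holds C T ∧ ∃ y ∈ joinCol S T j, target B C g.right = some y) := by
  constructor
  · rintro ⟨x | x, hx, y, hy, h⟩
    · rcases glue_fn_inl_eq_some.1 h with ⟨z, hz, rfl⟩ | ⟨h₁, h₂⟩
      · exact .inl (.inl ⟨x, hx, z, hy, hz⟩)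
      · exact .inr (.inl ⟨⟨x, hx, h₁⟩, y, hy, h₂⟩)
    · rcases glue_fn_inr_eq_some.1 h with ⟨z, hz, rfl⟩ | ⟨h₁, h₂⟩
      · exact .inl (.inr ⟨x, hx, z, hy, hz⟩)
      · exact .inr (.inr ⟨⟨x, hx, h₁⟩, y, hy, h₂⟩)
  · rintro ((⟨x, hx, z, hz, h⟩ | ⟨x, hx, z, hz, h⟩) | ⟨⟨x, hx, h₁⟩, y, hy, h₂⟩ |
      ⟨⟨x, hx, h₁⟩, y, hy, h₂⟩)
    · exact ⟨.inl x, hx, .inl z, hz, glue_fn_inl_eq_some.2 (.inl ⟨z, h, rfl⟩)⟩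
    · exact ⟨.inr x, hx, .inr z, hz, glue_fn_inr_eq_some.2 (.inl ⟨z, h, rfl⟩)⟩
    · exact ⟨.inl x, hx, y, hy, glue_fn_inl_eq_some.2 (.inr ⟨h₁, h₂⟩)⟩
    · exact ⟨.inr x, hx, y, hy, glue_fn_inr_eq_some.2 (.inr ⟨h₁, h₂⟩)⟩

theorem holds_glue_congr (g : Gluing) (hB : ∀ a : Atom ι, a.Holds B S ↔ a.Holds B' S')
    (hC : ∀ a : Atom ι, a.Holds C T ↔ a.Holds C' T') (a : Atom ι) :
    a.Holds (glue g B C) (joinCol S T) ↔ a.Holds (glue g B' C') (joinCol S' T') := by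
  have hn := target_eq_none_congr hB hC
  cases a with
  | meets i j =>
    simp only [Atom.Holds, exists_glue]
    exact or_congr (hB (.meets i j)) (hC (.meets i j))
  | many i => simp only [holds_glue_many, hB, hC]
  | edge i j => simp only [holds_glue_edge, hB, hC, target_mem_congr hB hC]
  | exit i =>
    have h₁ := hB (.exit i)
    have h₂ := hC (.exit i)
    simp only [Atom.Holds] at h₁ h₂
    simp only [Atom.Holds, exists_glue, glue_fn_inl_eq_none, glue_fn_inr_eq_none,
      ← and_assoc, exists_and_right, hn]
    exact or_congr (and_congr_left' h₁) (and_congr_left' h₂)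
  | entry i => exact target_mem_congr hB hC g.entry i
  | hasExit =>
    have h₁ := hB .hasExit
    have h₂ := hC .hasExit
    simp only [Atom.Holds] at h₁ h₂
    simp only [Atom.Holds, exists_glue, glue_fn_inl_eq_none, glue_fn_inr_eq_none,
      exists_and_right, h₁, h₂, hn]
  | hasEntry =>
    have h := not_congr (hn g.entry)
    simp only [Option.ne_none_iff_exists'] at h
    exact h

/-- The type of a gluing is determined by the types of the two parts. -/
theorem tp_glue_congr (g : Gluing) (q : ℕ) (hB : tp B q S = tp B' q S')
    (hC : tp C q T = tp C' q T') :
    tp (glue g B C) q (joinCol S T) = tp (glue g B' C') q (joinCol S' T') := by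
  induction q generalizing S T S' T' with
  | zero =>
    exact Set.ext (holds_glue_congr g (holds_iff_of_tp_eq hB) (holds_iff_of_tp_eq hC))
  | succ q ih =>
    have key : ∀ {B C B' C' : PGraph} {S : ι → Set B.carrier} {T : ι → Set C.carrier}
        {S' : ι → Set B'.carrier} {T' : ι → Set C'.carrier},
        (∀ {S : ι → Set B.carrier} {T : ι → Set C.carrier} {S' : ι → Set B'.carrier}
          {T' : ι → Set C'.carrier}, tp B q S = tp B' q S' → tp C q T = tp C' q T' →
          tp (glue g B C) q (joinCol S T) = tp (glue g B' C') q (joinCol S' T')) →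
        tp B (q + 1) S = tp B' (q + 1) S' → tp C (q + 1) T = tp C' (q + 1) T' →
        ∀ (J : Set ι) X, (∀ i ∉ J, X i = joinCol S T i) → ∃ Y : ι → Set (glue g B' C').carrier,
          (∀ i ∉ J, Y i = joinCol S' T' i) ∧ tp (glue g B C) q X = tp (glue g B' C') q Y := by
      intro B C B' C' S T S' T' ih hB hC J X hX
      obtain ⟨Y₁, hY₁, e₁⟩ := exists_tp_eq_of_tp_succ_eq hB J (fun i => Sum.inl ⁻¹' X i)
        fun i hi => by rw [hX i hi]; rfl
      obtain ⟨Y₂, hY₂, e₂⟩ := exists_tp_eq_of_tp_succ_eq hC J (fun i => Sum.inr ⁻¹' X i)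
        fun i hi => by rw [hX i hi]; rfl
      refine ⟨joinCol Y₁ Y₂, fun i hi => ?_, ?_⟩
      · unfold joinCol
        rw [hY₁ i hi, hY₂ i hi]
      rw [← ih e₁ e₂]
      congr 1
      funext i
      ext x
      cases x <;> rfl
    refine tp_succ_eq (holds_glue_congr g (holds_iff_of_tp_eq hB) (holds_iff_of_tp_eq hC))
      (key ih hB hC) fun J Y hY => ?_
    obtain ⟨X, hX, e⟩ := key (fun h h' => (ih h.symm h'.symm).symm) hB.symm hC.symm J Y hY
    exact ⟨X, hX, e.symm⟩

end glue

/-! ### Building graphs by gluing -/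

namespace PGraph

/-- The graph induced on a set `U` of points, with a new entry point. -/
noncomputable def restrict (P : PGraph) (U : Set P.carrier) (e : Option U) : PGraph where
  carrier := U
  fn x := open Classical in (P.fn x).bind fun y => if h : y ∈ U then some ⟨y, h⟩ else none
  entry := e

theorem restrict_fn_eq_some {P : PGraph} {U : Set P.carrier} {e : Option U} {x y : U} :
    (P.restrict U e).fn x = some y ↔ P.fn x = some y.1 := by
  obtain ⟨y, hy⟩ := y
  simp only [restrict, Option.bind_eq_some_iff, Option.dite_none_right_eq_some, Option.some.injEq]
  constructor
  · rintro ⟨z, hz, hU, h⟩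
    cases h
    exact hz
  · intro h
    exact ⟨y, h, hy, rfl⟩

theorem restrict_fn_eq_none {P : PGraph} {U : Set P.carrier} {e : Option U} {x : U} :
    (P.restrict U e).fn x = none ↔ ∀ y ∈ U, P.fn x ≠ some y := by
  rw [Option.eq_none_iff_forall_ne_some]
  constructor
  · intro h y hy hxy
    exact h ⟨y, hy⟩ (restrict_fn_eq_some.2 hxy)
  · intro h y hxy
    exact h y.1 y.2 (restrict_fn_eq_some.1 hxy)

/-- One step of the function. -/
abbrev Step (P : PGraph) (x y : P.carrier) : Prop := P.fn x = some y

/-- Every orbit ends in an exit. -/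
def Acyclic (P : PGraph) : Prop :=
  ∀ x, ∃ y, Relation.ReflTransGen P.Step x y ∧ P.fn y = none

theorem Acyclic.restrict {P : PGraph} (h : P.Acyclic) {U : Set P.carrier}
    (hU : ∀ x ∈ U, ∀ y, P.fn x = some y → y ∈ U) (e : Option U) : (P.restrict U e).Acyclic := by
  rintro ⟨x, hx⟩
  obtain ⟨y, hxy, hy⟩ := h x
  induction hxy using Relation.ReflTransGen.head_induction_on with
  | refl => exact ⟨⟨y, hx⟩, .refl, restrict_fn_eq_none.2 fun z _ => by simp [hy]⟩
  | head hxz _ ih =>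
    obtain ⟨w, hw, hw'⟩ := ih (hU _ hx _ hxz)
    exact ⟨w, .head (restrict_fn_eq_some (P := P).2 hxz) hw, hw'⟩

/-- If every point reaches `r`, then removing `r` destroys all cycles. -/
theorem acyclic_restrict_compl_singleton {P : PGraph} {r : P.carrier}
    (h : ∀ x, Relation.ReflTransGen P.Step x r) (e : Option ({r}ᶜ : Set P.carrier)) :
    (P.restrict {r}ᶜ e).Acyclic := by
  rintro ⟨x, hx⟩
  have hxr := h x
  induction hxr using Relation.ReflTransGen.head_induction_on with
  | refl => exact absurd rfl hx
  | @head x z hxz _ ih =>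
    by_cases hz : z = r
    · subst hz
      refine ⟨_, .refl, restrict_fn_eq_none.2 fun y hy hxy => hy ?_⟩
      exact Option.some_injective _ (hxy.symm.trans hxz)
    · obtain ⟨w, hw, hw'⟩ := ih hz
      exact ⟨w, .head (restrict_fn_eq_some (P := P).2 hxz) hw, hw'⟩

/-- The point of `P` designated by a gluing instruction for a graph induced on a set with entry `e₁`
and a graph induced on its complement with entry `e₂`. -/
def targetOf {P : PGraph} {U : Set P.carrier} (e₁ : Option U) (e₂ : Option (Uᶜ : Set P.carrier)) :
    Option Bool → Option P.carrier
  | none => none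
  | some false => e₁.map Subtype.val
  | some true => e₂.map Subtype.val

open Classical in
/-- The gluing of the graphs induced on `U` and on its complement is the whole graph, provided that
all edges between the two parts, and the entry point, agree with the instructions. -/
noncomputable def glueRestrict (P : PGraph) {U : Set P.carrier} (e₁ : Option U)
    (e₂ : Option (Uᶜ : Set P.carrier)) (g : Gluing)
    (h₁ : ∀ x ∈ U, (∃ y ∈ U, P.fn x = some y) ∨ P.fn x = targetOf e₁ e₂ g.left)
    (h₂ : ∀ x ∉ U, (∃ y ∉ U, P.fn x = some y) ∨ P.fn x = targetOf e₁ e₂ g.right)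
    (h₃ : P.entry = targetOf e₁ e₂ g.entry) :
    PIso (glue g (P.restrict U e₁) (P.restrict Uᶜ e₂)) P :=
  have ht : ∀ o, targetOf e₁ e₂ o =
      (target (P.restrict U e₁) (P.restrict Uᶜ e₂) o).map (Equiv.Set.sumCompl U) := by
    rintro (_ | _ | _)
    · rfl
    · cases e₁ <;> rfl
    · cases e₂ <;> rfl
  { toEquiv := Equiv.Set.sumCompl U
    fn_map := by
      rintro (⟨x, hxU⟩ | ⟨x, hxU⟩)
      · by_cases hx : ∃ y ∈ U, P.fn x = some y
        · obtain ⟨y, hy, hxy⟩ := hx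
          have : (P.restrict U e₁).fn ⟨x, hxU⟩ = some ⟨y, hy⟩ := restrict_fn_eq_some.2 hxy
          exact hxy.trans
            (congrArg (Option.map (Equiv.Set.sumCompl U))
              (glue_fn_inl_eq_some (g := g) (C := P.restrict Uᶜ e₂) |>.2
                (.inl ⟨_, this, rfl⟩))).symm
        · have hx' := (h₁ x hxU).resolve_left hx
          have : (P.restrict U e₁).fn ⟨x, hxU⟩ = none :=
            restrict_fn_eq_none.2 fun y hy hxy => hx ⟨y, hy, hxy⟩
          exact (hx'.trans (ht _)).trans
            (congrArg (Option.map (Equiv.Set.sumCompl U))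
              (glue_fn_inl_of_eq_none (C := P.restrict Uᶜ e₂) g this)).symm
      · by_cases hx : ∃ y ∈ Uᶜ, P.fn x = some y
        · obtain ⟨y, hy, hxy⟩ := hx
          have : (P.restrict Uᶜ e₂).fn ⟨x, hxU⟩ = some ⟨y, hy⟩ := restrict_fn_eq_some.2 hxy
          exact hxy.trans
            (congrArg (Option.map (Equiv.Set.sumCompl U))
              (glue_fn_inr_eq_some (g := g) (B := P.restrict U e₁) |>.2 (.inl ⟨_, this, rfl⟩))).symm
        · have hx' := (h₂ x hxU).resolve_left hx
          have : (P.restrict Uᶜ e₂).fn ⟨x, hxU⟩ = none :=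
            restrict_fn_eq_none.2 fun y hy hxy => hx ⟨y, hy, hxy⟩
          exact (hx'.trans (ht _)).trans
            (congrArg (Option.map (Equiv.Set.sumCompl U))
              (glue_fn_inr_of_eq_none (B := P.restrict U e₁) g this)).symm
    entry_map := h₃.trans (ht _) }

/-- For some `r`, the set of points that reach `r` is closed under the function: take a point
reached by as many points as possible. Such an `r` is an exit or lies on a cycle. -/
theorem exists_stable (P : PGraph) [Finite P.carrier] [Nonempty P.carrier] :
    ∃ r, ∀ x, Relation.ReflTransGen P.Step x r → ∀ y, P.Step x y →
      Relation.ReflTransGen P.Step y r := by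
  obtain ⟨r, hr⟩ := Finite.exists_max fun r => {x | Relation.ReflTransGen P.Step x r}.ncard
  refine ⟨r, fun x hx y hxy => ?_⟩
  rcases Relation.ReflTransGen.cases_head hx with rfl | ⟨z, hxz, hz⟩
  · have hsub : {z | Relation.ReflTransGen P.Step z x} ⊆ {z | Relation.ReflTransGen P.Step z y} :=
      fun z hz => .tail hz hxy
    have := Set.eq_of_subset_of_ncard_le hsub (hr y) (Set.toFinite _)
    have hy : y ∈ {z | Relation.ReflTransGen P.Step z y} := .refl
    rwa [← this] at hy
  · cases Option.some_injective _ (hxz.symm.trans hxy)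
    exact hz

end PGraph

/-- The graphs built from one-point graphs by gluing, up to isomorphism. -/
inductive Gen : PGraph → Prop
  | point (P : PGraph) : Nat.card P.carrier = 1 → Gen P
  | glue (g : Gluing) {B C : PGraph} : Gen B → Gen C → Gen (glue g B C)
  | iso {P Q : PGraph} : PIso P Q → Gen P → Gen Q

/-- A finite graph that is acyclic or has no entry point can be built by gluing. -/
theorem gen_of_good (n : ℕ) : ∀ P : PGraph, Nat.card P.carrier = n → Finite P.carrier →
    Nonempty P.carrier → (P.entry = none ∨ P.Acyclic) → Gen P := by
  classical
  induction n using Nat.strong_induction_on with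
  | _ n ih =>
  intro P hn _ _ hP
  obtain ⟨r, hr⟩ := P.exists_stable
  have hlt : ∀ (U : Set P.carrier), U ≠ Set.univ → Nat.card U < n := fun U hU => by
    rw [Nat.card_coe_set_eq, ← hn, ← Set.ncard_univ]
    exact Set.ncard_lt_ncard (Set.ssubset_univ_iff.2 hU)
  by_cases hT : ∀ x, Relation.ReflTransGen P.Step x r
  · by_cases h1 : n = 1
    · exact .point P (hn.trans h1)
    -- `P` is the point `r`, its own entry point, glued to the rest with entry point `e`
    have key : ∀ (e : Option ({r}ᶜ : Set P.carrier)) (g : Gluing),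
        ((∃ y ∈ ({r} : Set P.carrier), P.fn r = some y) ∨
          P.fn r = PGraph.targetOf (some ⟨r, Set.mem_singleton r⟩) e g.left) →
        g.right = some false →
        P.entry = PGraph.targetOf (some ⟨r, Set.mem_singleton r⟩) e g.entry → Gen P := by
      intro e g hl hright he
      refine .iso (P.glueRestrict (some ⟨r, Set.mem_singleton r⟩) e g ?_ ?_ he)
        (.glue _ (.point _ ?_) ?_)
      · rintro _ rfl
        exact hl
      · intro x hx
        rcases Relation.ReflTransGen.cases_head (hT x) with rfl | ⟨z, hxz, -⟩
        · exact absurd rfl hx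
        · by_cases hz : z = r
          · subst hz
            exact .inr (by rw [hright]; exact hxz)
          · exact .inl ⟨z, hz, hxz⟩
      · exact Nat.card_unique (α := ({r} : Set P.carrier))
      · have hne : ({r}ᶜ : Set P.carrier) ≠ Set.univ := by simp
        refine ih _ (hlt _ hne) (P.restrict {r}ᶜ e) rfl (inferInstanceAs (Finite ({r}ᶜ : Set _))) ?_
          (.inr (PGraph.acyclic_restrict_compl_singleton hT e))
        by_contra hempty
        have : ∀ x : P.carrier, x = r := fun x => by
          by_contra hx
          exact hempty ⟨(⟨x, hx⟩ : ({r}ᶜ : Set P.carrier))⟩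
        have : Unique P.carrier := ⟨⟨r⟩, this⟩
        exact h1 (hn ▸ Nat.card_unique)
    rcases hf : P.fn r with _ | y
    · rcases he : P.entry with _ | p
      · exact key none ⟨none, some false, none⟩ (.inr hf) rfl he
      · by_cases hp : p = r
        · subst hp
          exact key none ⟨none, some false, some false⟩ (.inr hf) rfl he
        · exact key (some ⟨p, hp⟩) ⟨none, some false, some true⟩ (.inr hf) rfl he
    · have he : P.entry = none := by
        refine hP.resolve_right fun h => ?_
        obtain ⟨z, hrz, hz⟩ := h r
        -- the exit `z` cannot reach any other point, so that `z = r`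
        rcases Relation.ReflTransGen.cases_head (hT z) with rfl | ⟨w, hzw, -⟩
        · simp [hf] at hz
        · simp [hz, PGraph.Step] at hzw
      by_cases hy : y = r
      · subst hy
        exact key none ⟨none, some false, none⟩ (.inl ⟨_, rfl, hf⟩) rfl he
      · exact key (some ⟨y, hy⟩) ⟨some true, some false, none⟩ (.inr hf) rfl he
  · set U : Set P.carrier := {x | Relation.ReflTransGen P.Step x r} with hU
    obtain ⟨x₀, hx₀⟩ := not_forall.1 hT
    have hstep : ∀ x ∈ U, ∀ y, P.fn x = some y → y ∈ U := hr
    have hstep' : ∀ x ∈ Uᶜ, ∀ y, P.fn x = some y → y ∈ Uᶜ := fun x hx y hxy hy =>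
      hx (.head hxy hy)
    have key : ∀ (e₁ : Option U) (e₂ : Option (Uᶜ : Set P.carrier)) (g : Gluing),
        g.left = none → g.right = none → P.entry = PGraph.targetOf e₁ e₂ g.entry →
        (e₁ = none ∨ P.Acyclic) → (e₂ = none ∨ P.Acyclic) → Gen P := by
      intro e₁ e₂ g hl hright he h₁ h₂
      refine .iso (P.glueRestrict e₁ e₂ g (fun x hx => ?_) (fun x hx => ?_) he) (.glue _ ?_ ?_)
      · rw [hl]
        rcases hf : P.fn x with _ | y
        · exact .inr rfl
        · exact .inl ⟨y, hstep x hx y hf, rfl⟩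
      · rw [hright]
        rcases hf : P.fn x with _ | y
        · exact .inr rfl
        · exact .inl ⟨y, hstep' x hx y hf, rfl⟩
      · exact ih _ (hlt U fun h => hx₀ (h ▸ Set.mem_univ x₀ : x₀ ∈ U)) (P.restrict U e₁) rfl
          (inferInstanceAs (Finite U)) ⟨(⟨r, .refl⟩ : U)⟩ (h₁.imp id fun h => h.restrict hstep e₁)
      · exact ih _ (hlt Uᶜ fun h => (h ▸ Set.mem_univ r : r ∈ Uᶜ) .refl) (P.restrict Uᶜ e₂) rfl
          (inferInstanceAs (Finite (Uᶜ : Set _))) ⟨(⟨x₀, hx₀⟩ : (Uᶜ : Set P.carrier))⟩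
          (h₂.imp id fun h => h.restrict hstep' e₂)
    rcases he : P.entry with _ | p
    · exact key none none ⟨none, none, none⟩ rfl rfl he (.inl rfl) (.inl rfl)
    · have hac := hP.resolve_left (by simp [he])
      by_cases hp : p ∈ U
      · exact key (some ⟨p, hp⟩) none ⟨none, none, some false⟩ rfl rfl he (.inr hac) (.inr hac)
      · exact key none (some ⟨p, hp⟩) ⟨none, none, some true⟩ rfl rfl he (.inr hac) (.inr hac)

theorem Gen.finite {P : PGraph} (h : Gen P) : Finite P.carrier := by
  induction h with
  | point P h => exact Nat.finite_of_card_ne_zero (by simp [h])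
  | glue g _ _ ihB ihC => exact inferInstanceAs (Finite (_ ⊕ _))
  | iso e _ ih => exact Finite.of_equiv _ e.toEquiv

theorem Gen.card_pos {P : PGraph} (h : Gen P) : 0 < Nat.card P.carrier := by
  induction h with
  | point P h => simp [h]
  | @glue g B C hB hC ihB ihC =>
    have := hB.finite
    have := hC.finite
    have : Nat.card (MSOUnary.glue g B C).carrier = _ :=
      Nat.card_sum (α := B.carrier) (β := C.carrier)
    omega
  | iso e _ ih => rwa [← Nat.card_congr e.toEquiv]

/-- Up to the type of a colouring, a generated graph is a point or a gluing of smaller ones. -/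
theorem Gen.cases_tp {ι : Type} {P : PGraph} (h : Gen P) (q : ℕ) (S : ι → Set P.carrier) :
    Nat.card P.carrier = 1 ∨ ∃ (g : Gluing) (B C : PGraph) (X : ι → Set B.carrier)
      (Y : ι → Set C.carrier), Gen B ∧ Gen C ∧ tp P q S = tp (MSOUnary.glue g B C) q (joinCol X Y) ∧
      Nat.card P.carrier = Nat.card B.carrier + Nat.card C.carrier := by
  induction h with
  | point P h => exact .inl h
  | @glue g B C hB hC _ _ =>
    have := hB.finite
    have := hC.finite
    refine .inr ⟨g, B, C, fun i => Sum.inl ⁻¹' S i, fun i => Sum.inr ⁻¹' S i, hB, hC, ?_,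
      Nat.card_sum (α := B.carrier) (β := C.carrier)⟩
    congr 1
    funext i
    ext x
    cases x <;> rfl
  | iso e _ ih => simpa only [e.tp_eq, Nat.card_congr e.toEquiv] using ih fun i => e.toEquiv ⁻¹' S i

/-! ### The number of types -/

/-- Atomic properties as a kind together with at most two colours. -/
def Atom.toTriple {ι : Type} : Atom ι → Fin 7 × Option ι × Option ι
  | meets i j => (0, some i, some j)
  | many i => (1, some i, none)
  | edge i j => (2, some i, some j)
  | exit i => (3, some i, none)
  | entry i => (4, some i, none)
  | hasExit => (5, none, none)
  | hasEntry => (6, none, none)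

theorem Atom.toTriple_injective {ι : Type} : Function.Injective (toTriple (ι := ι)) := by
  rintro (_ | _ | _ | _ | _ | _ | _) (_ | _ | _ | _ | _ | _ | _) <;> simp [toTriple]

instance (ι : Type) [Finite ι] : Finite (Atom ι) := .of_injective _ Atom.toTriple_injective

theorem Atom.card_le (ι : Type) [Finite ι] :
    Nat.card (Atom ι) ≤ 7 * ((Nat.card ι + 1) * (Nat.card ι + 1)) := by
  refine (Nat.card_le_card_of_injective _ Atom.toTriple_injective).trans_eq ?_
  simp [Nat.card_prod, Finite.card_option]

instance Ty.finite (ι : Type) [Finite ι] (q : ℕ) : Finite (Ty ι q) := by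
  induction q with
  | zero => exact inferInstanceAs (Finite (Set (Atom ι)))
  | succ q ih => exact inferInstanceAs (Finite (Set (Atom ι) × (Set ι → Set (Ty ι q))))

/-- An upper bound for the number of types of rank `q` over `u` colours. -/
def typeBound (u : ℕ) : ℕ → ℕ
  | 0 => 2 ^ (7 * ((u + 1) * (u + 1)))
  | q + 1 => 2 ^ (7 * ((u + 1) * (u + 1))) * (2 ^ typeBound u q) ^ 2 ^ u

theorem card_set {α : Type} [Finite α] : Nat.card (Set α) = 2 ^ Nat.card α := by
  have := Fintype.ofFinite α
  simp [Nat.card_eq_fintype_card]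

theorem Ty.card_le (ι : Type) [Finite ι] (q : ℕ) :
    Nat.card (Ty ι q) ≤ typeBound (Nat.card ι) q := by
  have hA : Nat.card (Set (Atom ι)) ≤ 2 ^ (7 * ((Nat.card ι + 1) * (Nat.card ι + 1))) := by
    rw [card_set]
    exact Nat.pow_le_pow_right (by norm_num) (Atom.card_le ι)
  induction q with
  | zero => exact hA
  | succ q ih =>
    change Nat.card (Set (Atom ι) × (Set ι → Set (Ty ι q))) ≤ _
    rw [Nat.card_prod, Nat.card_fun, card_set (α := Ty ι q), card_set (α := ι), typeBound]
    exact Nat.mul_le_mul hA (Nat.pow_le_pow_left (Nat.pow_le_pow_right (by norm_num) ih) _)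

/-! ### Small graphs of every type -/

/-- If every value of `s` on `R` is at most `1` or at most the sum of two smaller values, then these
values are at most exponential in the number of elements. -/
theorem le_two_pow_of_splits {T : Type} [Finite T] (R : Set T) (s : T → ℕ)
    (h : ∀ t ∈ R, s t ≤ 1 ∨ ∃ t₁ ∈ R, ∃ t₂ ∈ R, s t₁ < s t ∧ s t₂ < s t ∧ s t ≤ s t₁ + s t₂) :
    ∀ t ∈ R, s t ≤ 2 ^ Nat.card T := by
  have key : ∀ n, ∀ t ∈ R, s t = n → s t ≤ 2 ^ {t' | s t' < s t}.ncard := by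
    intro n
    induction n using Nat.strong_induction_on with
    | _ n ih =>
      have aux : ∀ t ∈ R, s t = n → ∀ t₁ ∈ R, s t₁ < s t → s t ≤ 2 * s t₁ →
          s t ≤ 2 ^ {t' | s t' < s t}.ncard := by
        intro t _ hn t₁ ht₁ hlt hle
        -- `t₁` itself lies in the larger set only
        have hss : {t' | s t' < s t₁} ⊂ {t' | s t' < s t} := by
          refine ⟨fun t' (ht' : _ < _) => ht'.trans hlt, fun hsub => ?_⟩
          have : s t₁ < s t₁ := hsub (show t₁ ∈ {t' | s t' < s t} from hlt)
          exact lt_irrefl _ this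
        have hcard := Set.ncard_lt_ncard hss (Set.toFinite _)
        calc s t ≤ 2 * s t₁ := hle
          _ ≤ 2 * 2 ^ {t' | s t' < s t₁}.ncard := by
            have := ih (s t₁) (hn ▸ hlt) t₁ ht₁ rfl
            omega
          _ = 2 ^ ({t' | s t' < s t₁}.ncard + 1) := by rw [pow_succ, mul_comm]
          _ ≤ _ := Nat.pow_le_pow_right (by norm_num) hcard
      intro t ht hn
      rcases h t ht with h1 | ⟨t₁, ht₁, t₂, ht₂, h₁, h₂, hle⟩
      · exact h1.trans Nat.one_le_two_pow
      · rcases le_total (s t₁) (s t₂) with h' | h'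
        · exact aux t ht hn t₂ ht₂ h₂ (by omega)
        · exact aux t ht hn t₁ ht₁ h₁ (by omega)
  intro t ht
  refine (key _ t ht rfl).trans (Nat.pow_le_pow_right (by norm_num) ?_)
  rw [← Set.ncard_univ]
  exact Set.ncard_le_ncard (Set.subset_univ _)

/-- Every generated coloured graph has the same type as one of bounded size: the least sizes of
generated graphs of the various types satisfy the hypothesis of `le_two_pow_of_splits`. -/
theorem Gen.exists_small {ι : Type} [Finite ι] {P : PGraph} (hP : Gen P) (q : ℕ)
    (S : ι → Set P.carrier) :
    ∃ (Q : PGraph) (T : ι → Set Q.carrier), Gen Q ∧ tp Q q T = tp P q S ∧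
      Nat.card Q.carrier ≤ 2 ^ Nat.card (Ty ι q) := by
  let sizes : Ty ι q → Set ℕ := fun t =>
    {n | ∃ (Q : PGraph) (T : ι → Set Q.carrier), Gen Q ∧ tp Q q T = t ∧ Nat.card Q.carrier = n}
  let R : Set (Ty ι q) := {t | (sizes t).Nonempty}
  have hsizes : ∀ (Q : PGraph) (T : ι → Set Q.carrier), Gen Q →
      tp Q q T ∈ R ∧ sInf (sizes (tp Q q T)) ≤ Nat.card Q.carrier := fun Q T hQ =>
    ⟨⟨_, Q, T, hQ, rfl, rfl⟩, Nat.sInf_le ⟨Q, T, hQ, rfl, rfl⟩⟩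
  have hmain := le_two_pow_of_splits R (fun t => sInf (sizes t)) ?_ _ (hsizes P S hP).1
  · obtain ⟨Q, T, hQ, hT, hc⟩ := Nat.sInf_mem (hsizes P S hP).1
    exact ⟨Q, T, hQ, hT, hc.trans_le hmain⟩
  · intro t ht
    obtain ⟨Q, T, hQ, rfl, hc⟩ := Nat.sInf_mem ht
    rcases hQ.cases_tp q T with h1 | ⟨g, B, C, X, Y, hB, hC, htp, hcard⟩
    · exact .inl (by omega)
    · have hB' := hsizes B X hB
      have hC' := hsizes C Y hC
      have := hB.card_pos
      have := hC.card_pos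
      refine .inr ⟨_, hB'.1, _, hC'.1, ?_, ?_, ?_⟩
      · omega
      · omega
      · -- gluing minimal graphs of the types of `B` and `C` gives the type of `Q`
        obtain ⟨B', X', hgB, hX', hcB⟩ := Nat.sInf_mem hB'.1
        obtain ⟨C', Y', hgC, hY', hcC⟩ := Nat.sInf_mem hC'.1
        have := hgB.finite
        have := hgC.finite
        have h := (hsizes (MSOUnary.glue g B' C') (joinCol X' Y') (.glue g hgB hgC)).2
        rw [tp_glue_congr g q hX' hY', ← htp] at h
        have hsum : Nat.card (MSOUnary.glue g B' C').carrier = _ :=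
          Nat.card_sum (α := B'.carrier) (β := C'.carrier)
        change sInf (sizes _) ≤ sInf (sizes _) + sInf (sizes _)
        omega

/-! ### Types determine satisfaction -/

namespace Term

/-- The variable of a term. -/
def head : Term → ℕ
  | var i => i
  | app t => t.head

/-- The number of function symbols in a term. -/
def depth : Term → ℕ
  | var _ => 0
  | app t => t.depth + 1

theorem eval_eq_iterate {A : Type} (M : Interp A) (v : ℕ → A) (t : Term) :
    t.eval M v = M.fn^[t.depth] (v t.head) := by
  induction t with
  | var i => rfl
  | app t ih => rw [eval, ih, depth, Function.iterate_succ_apply', head]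

/-- The variable index and the depth are less than `m`. -/
def Below (m : ℕ) (t : Term) : Prop := t.head < m ∧ t.depth < m

end Term

namespace Formula

/-- The nesting depth of quantifiers. -/
def rank : Formula → ℕ
  | eq _ _ | rel _ _ | mem _ _ => 0
  | neg φ => φ.rank
  | conj φ ψ => max φ.rank ψ.rank
  | ex _ φ | exSet _ φ => φ.rank + 1

/-- All indices of variables and of relation symbols, and the depths of all terms, are less than
`m`. -/
def Below (m : ℕ) : Formula → Prop
  | eq s t => s.Below m ∧ t.Below m
  | rel i t | mem t i => i < m ∧ t.Below m
  | neg φ => φ.Below m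
  | conj φ ψ => φ.Below m ∧ ψ.Below m
  | ex i φ | exSet i φ => i < m ∧ φ.Below m

end Formula

/-- The colours used to describe an interpretation with assignments: `(i, k)` stands for the
value of the term `f^k(xᵢ)`, the other indices for the set variables and the relation symbols. -/
abbrev Colour (m : ℕ) : Type := (Fin m × Fin m) ⊕ (Fin m ⊕ Fin m)

/-- The graph of the function symbol. -/
abbrev Interp.graph {A : Type} (M : Interp A) : PGraph := ⟨A, fun x => some (M.fn x), none⟩

/-- The colouring that describes an interpretation with assignments. Elements are represented by
singletons. -/
def Interp.colouring {A : Type} (M : Interp A) (m : ℕ) (v : ℕ → A) (V : ℕ → Set A) :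
    Colour m → Set A
  | .inl (i, k) => {M.fn^[k] (v i)}
  | .inr (.inl i) => V i
  | .inr (.inr i) => M.rel i

/-- A sequence of singletons that are linked by `f` is an orbit. -/
theorem exists_orbit {A : Type} [Nonempty A] {m : ℕ} (f : A → A) (T : Fin m → Set A)
    (hne : ∀ k, ∃ x, x ∈ T k) (hs : ∀ k, ∀ x ∈ T k, ∀ y ∈ T k, x = y)
    (he : ∀ (k : ℕ) (h : k + 1 < m), ∃ x ∈ T ⟨k, by omega⟩, f x ∈ T ⟨k + 1, h⟩) :
    ∃ a, ∀ k, T k = {f^[k] a} := by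
  rcases Nat.eq_zero_or_pos m with rfl | hm
  · exact ⟨Classical.arbitrary A, fun k => k.elim0⟩
  obtain ⟨a, ha⟩ := hne ⟨0, hm⟩
  have key : ∀ k (h : k < m), f^[k] a ∈ T ⟨k, h⟩ := by
    intro k
    induction k with
    | zero => exact fun _ => ha
    | succ k ih =>
      intro h
      obtain ⟨x, hx, hfx⟩ := he k h
      rw [Function.iterate_succ_apply', hs _ _ (ih (by omega)) x hx]
      exact hfx
  exact ⟨a, fun k => Set.eq_singleton_iff_unique_mem.2
    ⟨key k k.2, fun y hy => hs k y hy _ (key k k.2)⟩⟩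

/-- A colouring with the same atomic properties as the colouring of an interpretation assigns an
orbit to each individual variable. -/
theorem exists_orbit_of_holds {A A' : Type} [Nonempty A'] {m : ℕ} {M : Interp A} {v : ℕ → A}
    {V : ℕ → Set A} {M' : Interp A'} {T : Colour m → Set A'}
    (h : ∀ a : Atom (Colour m), a.Holds M.graph (M.colouring m v V) ↔ a.Holds M'.graph T)
    (i : Fin m) : ∃ a, ∀ k, T (.inl (i, k)) = {M'.fn^[k] a} := by
  refine exists_orbit M'.fn (fun k => T (.inl (i, k))) (fun k => ?_) (fun k x hx y hy => ?_)
    fun k hk => ?_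
  · obtain ⟨x, hx, -⟩ := (h (.meets (.inl (i, k)) (.inl (i, k)))).1 ⟨_, rfl, rfl⟩
    exact ⟨x, hx⟩
  · by_contra hxy
    obtain ⟨x, hx, y, hy, hne⟩ := (h (.many (.inl (i, k)))).2 ⟨x, hx, y, hy, hxy⟩
    exact hne (hx.trans hy.symm)
  · obtain ⟨x, hx, y, hy, hxy⟩ := (h (.edge (.inl (i, ⟨k, by omega⟩)) (.inl (i, ⟨k + 1, hk⟩)))).1
      ⟨_, rfl, _, rfl, congrArg some (Function.iterate_succ_apply' _ _ _).symm⟩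
    exact ⟨x, hx, Option.some_injective _ hxy ▸ hy⟩

theorem meets_term_iff {A : Type} {M : Interp A} {m : ℕ} {v : ℕ → A} {V : ℕ → Set A} {t : Term}
    (ht : t.Below m) (c : Colour m) :
    (Atom.meets (.inl (⟨t.head, ht.1⟩, ⟨t.depth, ht.2⟩)) c).Holds M.graph (M.colouring m v V) ↔
      t.eval M v ∈ M.colouring m v V c := by
  rw [t.eval_eq_iterate]
  exact ⟨fun ⟨x, hx, hc⟩ => hx ▸ hc, fun hc => ⟨_, rfl, hc⟩⟩

/-- Coloured graphs of the same type of rank `q` satisfy the same formulas of rank at most `q`. A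
quantifier over `xᵢ` recolours the block of all terms `f^k(xᵢ)` at once. -/
theorem sat_iff_of_tp_eq {m : ℕ} (φ : Formula) (hφ : φ.Below m) (q : ℕ) (hq : φ.rank ≤ q)
    {A A' : Type} (M : Interp A) (v : ℕ → A) (V : ℕ → Set A) (M' : Interp A') (v' : ℕ → A')
    (V' : ℕ → Set A')
    (h : tp M.graph q (M.colouring m v V) = tp M'.graph q (M'.colouring m v' V')) :
    φ.Sat M v V ↔ φ.Sat M' v' V' := by
  induction φ generalizing q A A' with
  | eq s t =>
    have h' := holds_iff_of_tp_eq h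
      (.meets (.inl (⟨s.head, hφ.1.1⟩, ⟨s.depth, hφ.1.2⟩))
        (.inl (⟨t.head, hφ.2.1⟩, ⟨t.depth, hφ.2.2⟩)))
    rw [meets_term_iff hφ.1, meets_term_iff hφ.1] at h'
    simp only [Formula.Sat, t.eval_eq_iterate]
    exact h'
  | rel i t =>
    have h' := holds_iff_of_tp_eq h
      (.meets (.inl (⟨t.head, hφ.2.1⟩, ⟨t.depth, hφ.2.2⟩)) (.inr (.inr ⟨i, hφ.1⟩)))
    rwa [meets_term_iff hφ.2, meets_term_iff hφ.2] at h'
  | mem t i =>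
    have h' := holds_iff_of_tp_eq h
      (.meets (.inl (⟨t.head, hφ.2.1⟩, ⟨t.depth, hφ.2.2⟩)) (.inr (.inl ⟨i, hφ.1⟩)))
    rwa [meets_term_iff hφ.2, meets_term_iff hφ.2] at h'
  | neg φ ih => exact not_congr (ih hφ q hq M v V M' v' V' h)
  | conj φ ψ ih₁ ih₂ =>
    exact and_congr (ih₁ hφ.1 q ((le_max_left _ _).trans hq) M v V M' v' V' h)
      (ih₂ hφ.2 q ((le_max_right _ _).trans hq) M v V M' v' V' h)
  | ex i φ ih =>
    obtain ⟨q, rfl⟩ : ∃ q', q = q' + 1 := ⟨q - 1, by simp only [Formula.rank] at hq; omega⟩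
    have hq' : φ.rank ≤ q := by simpa [Formula.rank] using hq
    have key : ∀ {A A' : Type} (M : Interp A) (v : ℕ → A) (V : ℕ → Set A) (M' : Interp A')
        (v' : ℕ → A') (V' : ℕ → Set A'),
        tp M.graph (q + 1) (M.colouring m v V) = tp M'.graph (q + 1) (M'.colouring m v' V') →
        (Formula.ex i φ).Sat M v V → (Formula.ex i φ).Sat M' v' V' := by
      rintro A A' M v V M' v' V' h ⟨a, ha⟩
      obtain ⟨Y, hY, e⟩ := exists_tp_eq_of_tp_succ_eq h (Set.range fun k => .inl (⟨i, hφ.1⟩, k))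
        (M.colouring m (Function.update v i a) V) (by
          rintro (⟨j, k⟩ | j | j) hj
          · have hji : (j : ℕ) ≠ i := by
              rintro rfl
              exact hj ⟨k, rfl⟩
            simp [Interp.colouring, Function.update_of_ne hji]
          · rfl
          · rfl)
      have : Nonempty A' := ⟨v' 0⟩
      obtain ⟨a', ha'⟩ := exists_orbit_of_holds (holds_iff_of_tp_eq e) ⟨i, hφ.1⟩
      refine ⟨a', (ih hφ.2 q hq' M _ V M' _ V' ?_).1 ha⟩
      rw [e]
      congr 1
      funext c
      rcases c with ⟨j, k⟩ | j | j
      · by_cases hji : (j : ℕ) = i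
        · subst hji
          rw [ha' k]
          simp [Interp.colouring]
        · have hj : (Sum.inl (j, k) : Colour m) ∉ Set.range fun k => .inl (⟨i, hφ.1⟩, k) := by
            rintro ⟨k', hk⟩
            simp only [Sum.inl.injEq, Prod.mk.injEq] at hk
            exact hji (hk.1 ▸ rfl)
          rw [hY _ hj]
          simp [Interp.colouring, Function.update_of_ne hji]
      · exact hY _ (by simp)
      · exact hY _ (by simp)
    exact ⟨key M v V M' v' V' h, key M' v' V' M v V h.symm⟩
  | exSet i φ ih =>
    obtain ⟨q, rfl⟩ : ∃ q', q = q' + 1 := ⟨q - 1, by simp only [Formula.rank] at hq; omega⟩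
    have hq' : φ.rank ≤ q := by simpa [Formula.rank] using hq
    have key : ∀ {A A' : Type} (M : Interp A) (v : ℕ → A) (V : ℕ → Set A) (M' : Interp A')
        (v' : ℕ → A') (V' : ℕ → Set A'),
        tp M.graph (q + 1) (M.colouring m v V) = tp M'.graph (q + 1) (M'.colouring m v' V') →
        (Formula.exSet i φ).Sat M v V → (Formula.exSet i φ).Sat M' v' V' := by
      rintro A A' M v V M' v' V' h ⟨S, hS⟩
      obtain ⟨Y, hY, e⟩ := exists_tp_eq_of_tp_succ_eq h {.inr (.inl ⟨i, hφ.1⟩)}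
        (M.colouring m v (Function.update V i S)) (by
          rintro (⟨j, k⟩ | j | j) hj
          · rfl
          · have hji : (j : ℕ) ≠ i := by
              rintro rfl
              exact hj rfl
            simp [Interp.colouring, Function.update_of_ne hji]
          · rfl)
      refine ⟨Y (.inr (.inl ⟨i, hφ.1⟩)), (ih hφ.2 q hq' M v _ M' v' _ ?_).1 hS⟩
      rw [e]
      congr 1
      funext c
      rcases c with ⟨j, k⟩ | j | j
      · exact hY _ (by simp)
      · by_cases hji : (j : ℕ) = i
        · subst hji
          simp [Interp.colouring]
        · rw [hY _ (by rintro hk; exact hji (by simpa [Fin.ext_iff] using hk))]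
          simp [Interp.colouring, Function.update_of_ne hji]
      · exact hY _ (by simp)
    exact ⟨key M v V M' v' V' h, key M' v' V' M v V h.symm⟩

/-- A bound for the size of the smallest finite model, for formulas below `m` of rank `q`. -/
def modelBound (m q : ℕ) : ℕ := 2 ^ typeBound (m * m + (m + m)) q

/-- The small model property. -/
theorem Formula.FinitelySatisfiable.exists_small_model {φ : Formula} (h : φ.FinitelySatisfiable)
    {m : ℕ} (hm : φ.Below m) {q : ℕ} (hq : φ.rank ≤ q) :
    ∃ n < modelBound m q, ∃ (M : Interp (Fin (n + 1))) (v : ℕ → Fin (n + 1))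
      (V : ℕ → Set (Fin (n + 1))), φ.Sat M v V := by
  obtain ⟨A, _, _, M, v, V, hsat⟩ := h
  have hgen : Gen M.graph := gen_of_good _ M.graph rfl ‹_› ‹_› (.inl rfl)
  obtain ⟨Q, T, hQ, hT, hcard⟩ := hgen.exists_small q (M.colouring m v V)
  have hpos := hQ.card_pos
  have := hQ.finite
  obtain ⟨n, hn⟩ : ∃ n, Nat.card Q.carrier = n + 1 := ⟨_, (Nat.succ_pred_eq_of_pos hpos).symm⟩
  let e : Q.carrier ≃ Fin (n + 1) := Finite.equivFinOfCardEq hn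
  obtain ⟨F, en, T, hT⟩ : ∃ (F : Fin (n + 1) → Option (Fin (n + 1))) (en : Option (Fin (n + 1)))
      (T' : Colour m → Set (Fin (n + 1))),
      tp ⟨Fin (n + 1), F, en⟩ q T' = tp M.graph q (M.colouring m v V) := by
    let iso : PIso Q ⟨Fin (n + 1), fun x => (Q.fn (e.symm x)).map e, Q.entry.map e⟩ :=
      ⟨e, fun x => by simp, rfl⟩
    refine ⟨fun x => (Q.fn (e.symm x)).map e, Q.entry.map e, fun c => e.symm ⁻¹' T c, ?_⟩
    rw [← hT, ← iso.tp_eq]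
    congr 1
    funext c
    ext x
    simp [iso]
  -- the new graph is total and has no entry point, hence is the graph of a function
  have hatom := holds_iff_of_tp_eq hT
  obtain ⟨f, rfl⟩ : ∃ f : Fin (n + 1) → Fin (n + 1), F = fun x => some (f x) := by
    have hF : ∀ x, ∃ y, F x = some y := fun x => by
      rw [← Option.ne_none_iff_exists']
      intro hx
      obtain ⟨y, hy⟩ := (hatom .hasExit).1 ⟨x, hx⟩
      cases hy
    choose f hf using hF
    exact ⟨f, funext hf⟩
  obtain rfl : en = none := by
    by_contra hx
    obtain ⟨y, hy⟩ := (hatom .hasEntry).1 (Option.ne_none_iff_exists'.1 hx)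
    cases hy
  let M₁ : Interp (Fin (n + 1)) := ⟨f, fun i => {x | ∃ h : i < m, x ∈ T (.inr (.inr ⟨i, h⟩))}⟩
  change tp M₁.graph q T = _ at hT
  have horb := fun i => exists_orbit_of_holds (M' := M₁) (T := T) (holds_iff_of_tp_eq hT.symm) i
  choose v₁ hv₁ using horb
  refine ⟨n, ?_, M₁, fun i => if h : i < m then v₁ ⟨i, h⟩ else 0,
    fun i => {x | ∃ h : i < m, x ∈ T (.inr (.inl ⟨i, h⟩))}, ?_⟩
  · have : typeBound (Nat.card (Colour m)) q = typeBound (m * m + (m + m)) q := by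
      simp
    have := Nat.pow_le_pow_right (n := 2) (by norm_num) (this ▸ Ty.card_le (Colour m) q)
    rw [modelBound]
    omega
  · refine (sat_iff_of_tp_eq φ hm q hq M v V M₁ _ _ ?_).1 hsat
    rw [← hT]
    congr 1
    funext c
    rcases c with ⟨i, k⟩ | i | i
    · rw [hv₁]
      simp [Interp.colouring]
    · ext x
      simp [Interp.colouring]
    · ext x
      simp [Interp.colouring, M₁]

/-! ### Coding finite interpretations by numbers -/

/-- The digit of `e` at position `j` in base `b`. -/
def dig (b e j : ℕ) : ℕ := e / b ^ j % b

theorem dig_lt {b : ℕ} (hb : 0 < b) (e j : ℕ) : dig b e j < b := Nat.mod_lt _ hb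

theorem dig_eq_zero {b L e j : ℕ} (he : e < b ^ L) (hj : L ≤ j) : dig b e j = 0 := by
  rcases Nat.eq_zero_or_pos b with rfl | hb
  · rcases Nat.eq_zero_or_pos L with rfl | hL
    · simp_all [dig]
    · simp [zero_pow hL.ne'] at he
  · rw [dig, Nat.div_eq_of_lt (he.trans_le (Nat.pow_le_pow_right hb hj)), Nat.zero_mod]

theorem exists_digits {b : ℕ} (L : ℕ) (g : ℕ → ℕ) (hg : ∀ j, g j < b) :
    ∃ e < b ^ L, ∀ j < L, dig b e j = g j := by
  have hb : 0 < b := (Nat.zero_le _).trans_lt (hg 0)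
  induction L generalizing g with
  | zero => exact ⟨0, by simp, by simp⟩
  | succ L ih =>
    obtain ⟨e, he, h⟩ := ih (fun j => g (j + 1)) fun j => hg _
    refine ⟨g 0 + b * e, ?_, ?_⟩
    · have h1 := hg 0
      calc g 0 + b * e < b + b * e := by omega
        _ = b * (e + 1) := by ring
        _ ≤ b * b ^ L := Nat.mul_le_mul_left _ he
        _ = b ^ (L + 1) := by ring
    · rintro (_ | j) hj
      · simp [dig, Nat.add_mul_mod_self_left, Nat.mod_eq_of_lt (hg 0)]
      · rw [← h j (by omega), dig, dig, pow_succ', ← Nat.div_div_eq_div_mul,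
          Nat.add_mul_div_left _ _ hb, Nat.div_eq_of_lt (hg 0), zero_add]

/-- The value of the term with number `t` in the interpretation with universe `{0, …, n}` coded by
`e`. In base `2 ^ (n + 1)`, the digits of `e` at the positions `4 * i`, `4 * i + 1`, `4 * i + 2` and
`4 * i + 3` code the values of `xᵢ`, of `Xᵢ`, of `Pᵢ` and of `f` at `i`. -/
def valN (n e t : ℕ) : ℕ :=
  (fun x => dig (2 ^ (n + 1)) e (4 * x + 3) % (n + 1))^[t.unpair.2]
    (dig (2 ^ (n + 1)) e (4 * t.unpair.1) % (n + 1))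

/-- The element `x` lies in the set coded by the digit of `e` at position `j`: sets are coded by
bit masks. -/
def InN (n e j x : ℕ) : Prop := dig 2 (dig (2 ^ (n + 1)) e j) x = 1

/-- The codes `e` and `e'` agree up to the digit at position `p`. -/
def Agree (n L p e e' : ℕ) : Prop :=
  ∀ j < L, j ≠ p → dig (2 ^ (n + 1)) e' j = dig (2 ^ (n + 1)) e j

/-- The code `e` satisfies the formula with number `k`, provided that `T j` lists the codes that
satisfy the formula with number `j`, for `j < k`. -/
def Cond (n L : ℕ) (T : ℕ → List ℕ) (k e : ℕ) : Prop :=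
  (k % 7 = 0 ∧ valN n e (k / 7).unpair.1 = valN n e (k / 7).unpair.2) ∨
  (k % 7 = 1 ∧ InN n e (4 * (k / 7).unpair.1 + 2) (valN n e (k / 7).unpair.2)) ∨
  (k % 7 = 2 ∧ InN n e (4 * (k / 7).unpair.2 + 1) (valN n e (k / 7).unpair.1)) ∨
  (k % 7 = 3 ∧ ¬ ∃ e' ∈ T (k / 7), e' = e) ∨
  (k % 7 = 4 ∧ (∃ e' ∈ T (k / 7).unpair.1, e' = e) ∧ ∃ e' ∈ T (k / 7).unpair.2, e' = e) ∨
  (k % 7 = 5 ∧ ∃ e' ∈ T (k / 7).unpair.2, Agree n L (4 * (k / 7).unpair.1) e e') ∨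
  (k % 7 = 6 ∧ ∃ e' ∈ T (k / 7).unpair.2, Agree n L (4 * (k / 7).unpair.1 + 1) e e')

open Classical in
/-- The list of all codes with `L` digits that satisfy the formula with number `k` in the universe
`{0, …, n}`. -/
noncomputable def tab (n L k : ℕ) : List ℕ :=
  (List.range ((2 ^ (n + 1)) ^ L)).filter
    fun e => Cond n L (fun j => if _ : j < k then tab n L j else []) k e
termination_by k

theorem mem_tab {n L k e : ℕ} : e ∈ tab n L k ↔
    e < (2 ^ (n + 1)) ^ L ∧ Cond n L (fun j => if j < k then tab n L j else []) k e := by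
  rw [tab]
  simp

theorem Term.code_eq_pair (t : Term) : t.code = Nat.pair t.head t.depth := by
  induction t with
  | var i => rfl
  | app t ih => simp [code, ih, head, depth]

/-- The interpretation coded by a number. -/
def interpN (n e : ℕ) : Interp (Fin (n + 1)) where
  fn x := Fin.ofNat (n + 1) (dig (2 ^ (n + 1)) e (4 * x + 3))
  rel i := {x | InN n e (4 * i + 2) x}

/-- The assignment of individual variables coded by a number. -/
def assignN (n e i : ℕ) : Fin (n + 1) := Fin.ofNat (n + 1) (dig (2 ^ (n + 1)) e (4 * i))

/-- The assignment of set variables coded by a number. -/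
def setsN (n e i : ℕ) : Set (Fin (n + 1)) := {x | InN n e (4 * i + 1) x}

theorem valN_code (n e : ℕ) (t : Term) :
    valN n e t.code = ((t.eval (interpN n e) (assignN n e) : Fin (n + 1)) : ℕ) := by
  rw [t.eval_eq_iterate, t.code_eq_pair, valN, Nat.unpair_pair]
  generalize t.depth = d
  induction d with
  | zero => rfl
  | succ d ih =>
    rw [Function.iterate_succ_apply', Function.iterate_succ_apply']
    simp only at ih
    simp only [ih]
    rfl

theorem Agree.dig_eq {n L p e e' : ℕ} (h : Agree n L p e e') (he : e < (2 ^ (n + 1)) ^ L)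
    (he' : e' < (2 ^ (n + 1)) ^ L) {j : ℕ} (hj : j ≠ p) :
    dig (2 ^ (n + 1)) e' j = dig (2 ^ (n + 1)) e j := by
  rcases lt_or_ge j L with hL | hL
  · exact h j hL hj
  · rw [dig_eq_zero he hL, dig_eq_zero he' hL]

/-- One digit of a code can be changed at will. -/
theorem exists_agree {n L p : ℕ} (e : ℕ) {a : ℕ} (hp : p < L) (ha : a < 2 ^ (n + 1)) :
    ∃ e' < (2 ^ (n + 1)) ^ L, Agree n L p e e' ∧ dig (2 ^ (n + 1)) e' p = a := by
  obtain ⟨e', he', h⟩ := exists_digits (b := 2 ^ (n + 1)) L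
    (fun j => if j = p then a else dig (2 ^ (n + 1)) e j) fun j => by
      split_ifs
      · exact ha
      · exact dig_lt (by positivity) _ _
  exact ⟨e', he', fun j hj hjp => by rw [h j hj, if_neg hjp], by rw [h p hp, if_pos rfl]⟩

/-- Every subset of `{0, …, n}` has a bit mask. -/
theorem exists_mask {n : ℕ} (S : Set (Fin (n + 1))) :
    ∃ s < 2 ^ (n + 1), ∀ x : Fin (n + 1), dig 2 s x = 1 ↔ x ∈ S := by
  classical
  obtain ⟨s, hs, h⟩ := exists_digits (b := 2) (n + 1)
    (fun j => if ∃ x ∈ S, (x : ℕ) = j then 1 else 0) fun j => by split_ifs <;> norm_num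
  refine ⟨s, hs, fun x => ?_⟩
  rw [h x x.2]
  simp [Fin.val_inj]

theorem lt_two_pow_of_fin {n : ℕ} (a : Fin (n + 1)) : (a : ℕ) < 2 ^ (n + 1) :=
  a.2.trans Nat.lt_two_pow_self

/-- The entries of the table are exactly the codes of models. -/
theorem mem_tab_iff_sat {n L m : ℕ} (hL : 4 * m ≤ L) (φ : Formula) (hφ : φ.Below m) {e : ℕ}
    (he : e < (2 ^ (n + 1)) ^ L) :
    e ∈ tab n L φ.code ↔ φ.Sat (interpN n e) (assignN n e) (setsN n e) := by
  induction φ generalizing e with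
  | eq s t =>
    have h1 : (Formula.eq s t).code % 7 = 0 := by simp only [Formula.code]; omega
    have h2 : (Formula.eq s t).code / 7 = Nat.pair s.code t.code := by
      simp only [Formula.code]; omega
    simp [mem_tab (k := Formula.code (.eq s t)), Cond, he, h1, h2, valN_code, Formula.Sat,
      Fin.val_inj]
  | rel i t =>
    have h1 : (Formula.rel i t).code % 7 = 1 := by simp only [Formula.code]; omega
    have h2 : (Formula.rel i t).code / 7 = Nat.pair i t.code := by
      simp only [Formula.code]; omega
    simp [mem_tab (k := Formula.code (.rel i t)), Cond, he, h1, h2, valN_code, Formula.Sat, interpN]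
  | mem t i =>
    have h1 : (Formula.mem t i).code % 7 = 2 := by simp only [Formula.code]; omega
    have h2 : (Formula.mem t i).code / 7 = Nat.pair t.code i := by
      simp only [Formula.code]; omega
    simp [mem_tab (k := Formula.code (.mem t i)), Cond, he, h1, h2, valN_code, Formula.Sat, setsN]
  | neg φ ih =>
    have h1 : (Formula.neg φ).code % 7 = 3 := by simp only [Formula.code]; omega
    have h2 : (Formula.neg φ).code / 7 = φ.code := by simp only [Formula.code]; omega
    have h3 : φ.code < (Formula.neg φ).code := by simp only [Formula.code]; omega
    simp [mem_tab (k := Formula.code (.neg φ)), Cond, he, h1, h2, h3, Formula.Sat, ih hφ he]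
  | conj φ ψ ih₁ ih₂ =>
    have hl := Nat.left_le_pair φ.code ψ.code
    have hr := Nat.right_le_pair φ.code ψ.code
    have h1 : (Formula.conj φ ψ).code % 7 = 4 := by simp only [Formula.code]; omega
    have h2 : (Formula.conj φ ψ).code / 7 = Nat.pair φ.code ψ.code := by
      simp only [Formula.code]; omega
    have h3 : φ.code < (Formula.conj φ ψ).code := by simp only [Formula.code]; omega
    have h4 : ψ.code < (Formula.conj φ ψ).code := by simp only [Formula.code]; omega
    simp [mem_tab (k := Formula.code (.conj φ ψ)), Cond, he, h1, h2, h3, h4, Formula.Sat,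
      ih₁ hφ.1 he, ih₂ hφ.2 he]
  | ex i φ ih =>
    have hr := Nat.right_le_pair i φ.code
    have h1 : (Formula.ex i φ).code % 7 = 5 := by simp only [Formula.code]; omega
    have h2 : (Formula.ex i φ).code / 7 = Nat.pair i φ.code := by
      simp only [Formula.code]; omega
    have h3 : φ.code < (Formula.ex i φ).code := by simp only [Formula.code]; omega
    -- codes that agree up to the digit of `xᵢ` code the same data up to the value of `xᵢ`
    have hagree : ∀ e' < (2 ^ (n + 1)) ^ L, Agree n L (4 * i) e e' →
        (φ.Sat (interpN n e') (assignN n e') (setsN n e') ↔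
          φ.Sat (interpN n e) (Function.update (assignN n e) i (assignN n e' i)) (setsN n e)) := by
      intro e' he' h
      have hd := fun {j} => h.dig_eq he he' (j := j)
      have e₁ : interpN n e' = interpN n e := by
        simp only [interpN, InN, fun k => hd (show 4 * k + 3 ≠ 4 * i by omega),
          fun k => hd (show 4 * k + 2 ≠ 4 * i by omega)]
      have e₂ : setsN n e' = setsN n e := by
        funext k
        simp only [setsN, InN, hd (show 4 * k + 1 ≠ 4 * i by omega)]
      have e₃ : assignN n e' = Function.update (assignN n e) i (assignN n e' i) := by
        funext k
        by_cases hk : k = i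
        · subst hk
          simp
        · simp only [Function.update_of_ne hk, assignN, hd (show 4 * k ≠ 4 * i by omega)]
      rw [← e₃, e₁, e₂]
    simp only [mem_tab (k := Formula.code (.ex i φ)), Cond, he, h1, h2, h3, Nat.unpair_pair]
    simp only [Formula.Sat, true_and, false_and, false_or, or_false, if_true, 
      OfNat.ofNat_ne_zero, OfNat.ofNat_ne_one, Nat.reduceEqDiff]
    constructor
    · rintro ⟨e', he', h⟩
      have hlt := (mem_tab.1 he').1
      exact ⟨_, (hagree e' hlt h).1 ((ih hφ.2 hlt).1 he')⟩
    · rintro ⟨a, ha⟩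
      have hi : 4 * i < L := by have := hφ.1; omega
      obtain ⟨e', hlt, h, hd⟩ := exists_agree e hi (lt_two_pow_of_fin a)
      have hval : assignN n e' i = a := by simp [assignN, hd]
      exact ⟨e', (ih hφ.2 hlt).2 ((hagree e' hlt h).2 (by rwa [hval])), h⟩
  | exSet i φ ih =>
    have hr := Nat.right_le_pair i φ.code
    have h1 : (Formula.exSet i φ).code % 7 = 6 := by simp only [Formula.code]; omega
    have h2 : (Formula.exSet i φ).code / 7 = Nat.pair i φ.code := by
      simp only [Formula.code]; omega
    have h3 : φ.code < (Formula.exSet i φ).code := by simp only [Formula.code]; omega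
    have hagree : ∀ e' < (2 ^ (n + 1)) ^ L, Agree n L (4 * i + 1) e e' →
        (φ.Sat (interpN n e') (assignN n e') (setsN n e') ↔
          φ.Sat (interpN n e) (assignN n e) (Function.update (setsN n e) i (setsN n e' i))) := by
      intro e' he' h
      have hd := fun {j} => h.dig_eq he he' (j := j)
      have e₁ : interpN n e' = interpN n e := by
        simp only [interpN, InN, fun k => hd (show 4 * k + 3 ≠ 4 * i + 1 by omega),
          fun k => hd (show 4 * k + 2 ≠ 4 * i + 1 by omega)]
      have e₂ : assignN n e' = assignN n e := by
        funext k
        simp only [assignN, hd (show 4 * k ≠ 4 * i + 1 by omega)]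
      have e₃ : setsN n e' = Function.update (setsN n e) i (setsN n e' i) := by
        funext k
        by_cases hk : k = i
        · subst hk
          simp
        · simp only [Function.update_of_ne hk, setsN, InN,
            hd (show 4 * k + 1 ≠ 4 * i + 1 by omega)]
      rw [← e₃, e₁, e₂]
    simp only [mem_tab (k := Formula.code (.exSet i φ)), Cond, he, h1, h2, h3, Nat.unpair_pair]
    simp only [Formula.Sat, true_and, false_and, false_or, if_true, 
      OfNat.ofNat_ne_zero, OfNat.ofNat_ne_one, Nat.reduceEqDiff]
    constructor
    · rintro ⟨e', he', h⟩
      have hlt := (mem_tab.1 he').1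
      exact ⟨_, (hagree e' hlt h).1 ((ih hφ.2 hlt).1 he')⟩
    · rintro ⟨S, hS⟩
      have hi : 4 * i + 1 < L := by have := hφ.1; omega
      obtain ⟨s, hs, hmask⟩ := exists_mask S
      obtain ⟨e', hlt, h, hd⟩ := exists_agree e hi hs
      have hval : setsN n e' i = S := by
        ext x
        simp [setsN, InN, hd, hmask]
      exact ⟨e', (ih hφ.2 hlt).2 ((hagree e' hlt h).2 (by rwa [hval])), h⟩

theorem Term.below_code_succ (t : Term) : t.Below (t.code + 1) := by
  rw [t.code_eq_pair]
  exact ⟨Nat.lt_succ_of_le (Nat.left_le_pair _ _), Nat.lt_succ_of_le (Nat.right_le_pair _ _)⟩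

theorem Term.Below.mono {t : Term} {m m' : ℕ} (h : t.Below m) (hm : m ≤ m') : t.Below m' :=
  ⟨h.1.trans_le hm, h.2.trans_le hm⟩

theorem Formula.Below.mono {φ : Formula} {m m' : ℕ} (h : φ.Below m) (hm : m ≤ m') :
    φ.Below m' := by
  induction φ with
  | eq s t => exact ⟨h.1.mono hm, h.2.mono hm⟩
  | rel i t => exact ⟨h.1.trans_le hm, h.2.mono hm⟩
  | mem t i => exact ⟨h.1.trans_le hm, h.2.mono hm⟩
  | neg φ ih => exact ih h
  | conj φ ψ ih₁ ih₂ => exact ⟨ih₁ h.1, ih₂ h.2⟩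
  | ex i φ ih => exact ⟨h.1.trans_le hm, ih h.2⟩
  | exSet i φ ih => exact ⟨h.1.trans_le hm, ih h.2⟩

theorem Formula.below_code_succ (φ : Formula) : φ.Below (φ.code + 1) := by
  induction φ with
  | eq s t =>
    have hl := Nat.left_le_pair s.code t.code
    have hr := Nat.right_le_pair s.code t.code
    exact ⟨s.below_code_succ.mono (by simp only [code]; omega),
      t.below_code_succ.mono (by simp only [code]; omega)⟩
  | rel i t =>
    have hl := Nat.left_le_pair i t.code
    have hr := Nat.right_le_pair i t.code
    exact ⟨by simp only [code]; omega, t.below_code_succ.mono (by simp only [code]; omega)⟩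
  | mem t i =>
    have hl := Nat.left_le_pair t.code i
    have hr := Nat.right_le_pair t.code i
    exact ⟨by simp only [code]; omega, t.below_code_succ.mono (by simp only [code]; omega)⟩
  | neg φ ih => exact Below.mono (φ := φ) ih (by simp only [code]; omega)
  | conj φ ψ ih₁ ih₂ =>
    have hl := Nat.left_le_pair φ.code ψ.code
    have hr := Nat.right_le_pair φ.code ψ.code
    exact ⟨ih₁.mono (by simp only [code]; omega), ih₂.mono (by simp only [code]; omega)⟩
  | ex i φ ih | exSet i φ ih =>
    have hl := Nat.left_le_pair i φ.code
    have hr := Nat.right_le_pair i φ.code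
    exact ⟨by simp only [code]; omega, ih.mono (by simp only [code]; omega)⟩

theorem Formula.rank_le_code (φ : Formula) : φ.rank ≤ φ.code := by
  induction φ with
  | eq | rel | mem => exact Nat.zero_le _
  | neg φ ih => simp only [rank, code]; omega
  | conj φ ψ ih₁ ih₂ =>
    have hl := Nat.left_le_pair φ.code ψ.code
    have hr := Nat.right_le_pair φ.code ψ.code
    simp only [rank, code]
    omega
  | ex i φ ih | exSet i φ ih =>
    have hr := Nat.right_le_pair i φ.code
    simp only [rank, code]
    omega

theorem tp_graph_congr {A : Type} {M M' : Interp A} {m q : ℕ} {v v' : ℕ → A} {V V' : ℕ → Set A}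
    (hfn : M.fn = M'.fn) (hc : M.colouring m v V = M'.colouring m v' V') :
    tp M.graph q (M.colouring m v V) = tp M'.graph q (M'.colouring m v' V') := by
  obtain ⟨f, r⟩ := M
  obtain ⟨f', r'⟩ := M'
  obtain rfl : f = f' := hfn
  exact congrArg (tp _ q) hc

/-- Finite satisfiability as a bounded search. Codes need four digits for each index below
`φ.code + 1`, for the variables and relation symbols, and for each of the elements `0, …, n`. -/
theorem finitelySatisfiable_iff_tab (φ : Formula) : φ.FinitelySatisfiable ↔
    ∃ n < modelBound (φ.code + 1) φ.code, tab n (4 * (φ.code + n + 2)) φ.code ≠ [] := by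
  constructor
  · intro h
    obtain ⟨n, hn, M, v, V, hsat⟩ := h.exists_small_model φ.below_code_succ φ.rank_le_code
    refine ⟨n, hn, ?_⟩
    choose mask hmask hmask' using exists_mask (n := n)
    obtain ⟨e, he, hd⟩ := exists_digits (b := 2 ^ (n + 1)) (4 * (φ.code + n + 2))
      (fun j => if j % 4 = 0 then v (j / 4) else if j % 4 = 1 then mask (V (j / 4))
        else if j % 4 = 2 then mask (M.rel (j / 4)) else M.fn (Fin.ofNat (n + 1) (j / 4)))
      fun j => by
        split_ifs
        · exact lt_two_pow_of_fin _
        · exact hmask _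
        · exact hmask _
        · exact lt_two_pow_of_fin _
    have hmem := (mem_tab_iff_sat (m := φ.code + 1) (by omega) φ φ.below_code_succ he).2 ?_
    · exact List.ne_nil_of_mem hmem
    refine (sat_iff_of_tp_eq φ φ.below_code_succ _ φ.rank_le_code M v V _ _ _ ?_).1 hsat
    have hfn : M.fn = (interpN n e).fn := by
      funext x
      have h4 : (4 * (x : ℕ) + 3) / 4 = x := by omega
      have h5 : (4 * (x : ℕ) + 3) % 4 = 3 := by omega
      simp [interpN, hd (4 * x + 3) (by omega), h4, h5]
    refine tp_graph_congr hfn (funext fun c => ?_)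
    rcases c with ⟨i, k⟩ | i | i
    · have h4 : 4 * (i : ℕ) / 4 = i := by omega
      simp [Interp.colouring, hfn, assignN, hd (4 * i) (by omega), h4]
    · have h4 : (4 * (i : ℕ) + 1) / 4 = i := by omega
      have h5 : (4 * (i : ℕ) + 1) % 4 = 1 := by omega
      ext x
      simp [Interp.colouring, setsN, InN, hd (4 * i + 1) (by omega), h4, h5, hmask']
    · have h4 : (4 * (i : ℕ) + 2) / 4 = i := by omega
      have h5 : (4 * (i : ℕ) + 2) % 4 = 2 := by omega
      ext x
      simp [Interp.colouring, interpN, InN, hd (4 * i + 2) (by omega), h4, h5, hmask']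
  · rintro ⟨n, -, h⟩
    obtain ⟨e, he⟩ := List.exists_mem_of_ne_nil _ h
    exact ⟨Fin (n + 1), inferInstance, inferInstance, _, _, _,
      (mem_tab_iff_sat (m := φ.code + 1) (by omega) φ φ.below_code_succ (mem_tab.1 he).1).1 he⟩

/-! ### Computability -/

open Primrec

section

variable {α : Type} [Primcodable α]

theorem primrec_pow {f g : α → ℕ} (hf : Primrec f) (hg : Primrec g) :
    Primrec fun a => f a ^ g a :=
  (Primrec₂.unpaired'.1 Nat.Primrec.pow : Primrec₂ fun x y : ℕ => x ^ y).comp hf hg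

theorem primrec_affine (k c : ℕ) {f : α → ℕ} (hf : Primrec f) : Primrec fun a => k * f a + c :=
  nat_add.comp (nat_mul.comp (.const k) hf) (.const c)

theorem primrec_base {n : α → ℕ} (hn : Primrec n) : Primrec fun a => 2 ^ (n a + 1) :=
  primrec_pow (.const 2) (succ.comp hn)

theorem primrec_dig {b e j : α → ℕ} (hb : Primrec b) (he : Primrec e) (hj : Primrec j) :
    Primrec fun a => dig (b a) (e a) (j a) :=
  nat_mod.comp (nat_div.comp he (primrec_pow hb hj)) hb

theorem primrec_valN {n e t : α → ℕ} (hn : Primrec n) (he : Primrec e) (ht : Primrec t) :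
    Primrec fun a => valN (n a) (e a) (t a) := by
  refine nat_iterate (snd.comp (unpair.comp ht)) ?_ ?_
  · exact nat_mod.comp (primrec_dig (primrec_base hn) he
      (nat_mul.comp (.const 4) (fst.comp (unpair.comp ht)))) (succ.comp hn)
  · refine Primrec.to₂ (f := fun p : α × ℕ =>
      dig (2 ^ (n p.1 + 1)) (e p.1) (4 * p.2 + 3) % (n p.1 + 1)) ?_
    exact nat_mod.comp (primrec_dig (primrec_base (hn.comp fst)) (he.comp fst)
      (primrec_affine 4 3 snd)) (succ.comp (hn.comp fst))

theorem primrecPred_inN {n e j x : α → ℕ} (hn : Primrec n) (he : Primrec e) (hj : Primrec j)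
    (hx : Primrec x) : PrimrecPred fun a => InN (n a) (e a) (j a) (x a) :=
  Primrec.eq.comp (primrec_dig (.const 2) (primrec_dig (primrec_base hn) he hj) hx) (.const 1)

theorem primrecPred_agree {n L p e e' : α → ℕ} (hn : Primrec n) (hL : Primrec L) (hp : Primrec p)
    (he : Primrec e) (he' : Primrec e') :
    PrimrecPred fun a => Agree (n a) (L a) (p a) (e a) (e' a) := by
  have h : PrimrecRel fun (j : ℕ) (a : α) =>
      j = p a ∨ dig (2 ^ (n a + 1)) (e' a) j = dig (2 ^ (n a + 1)) (e a) j := by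
    refine PrimrecPred.or (Primrec.eq.comp fst (hp.comp snd)) (Primrec.eq.comp ?_ ?_)
    · exact primrec_dig (primrec_base (hn.comp snd)) (he'.comp snd) fst
    · exact primrec_dig (primrec_base (hn.comp snd)) (he.comp snd) fst
  refine (h.forall_mem_list.comp (list_range.comp hL) .id).of_eq fun a => ?_
  simp only [List.mem_range, Agree, id, or_iff_not_imp_left, ne_eq]

theorem primrecPred_exists_mem {l : α → List ℕ} {R : ℕ → α → Prop} (hl : Primrec l)
    (hR : PrimrecPred fun p : ℕ × α => R p.1 p.2) : PrimrecPred fun a => ∃ x ∈ l a, R x a :=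
  (PrimrecRel.exists_mem_list (R := R) hR).comp hl .id

theorem primrecPred_cond {n L k e : α → ℕ} {l : α → List (List ℕ)} (hn : Primrec n)
    (hL : Primrec L) (hk : Primrec k) (he : Primrec e) (hl : Primrec l) :
    PrimrecPred fun a => Cond (n a) (L a) (fun j => (l a).getD j []) (k a) (e a) := by
  have h₀ : Primrec fun a => k a / 7 := nat_div.comp hk (.const 7)
  have h₁ : Primrec fun a => (k a / 7).unpair.1 := fst.comp (unpair.comp h₀)
  have h₂ : Primrec fun a => (k a / 7).unpair.2 := snd.comp (unpair.comp h₀)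
  have hmod : ∀ c, PrimrecPred fun a => k a % 7 = c := fun c =>
    Primrec.eq.comp (nat_mod.comp hk (.const 7)) (.const c)
  have hget : ∀ {j : α → ℕ}, Primrec j → Primrec fun a => (l a).getD (j a) [] := fun hj =>
    (list_getD []).comp hl hj
  have hmem : ∀ {j : α → ℕ}, Primrec j → PrimrecPred fun a =>
      ∃ e' ∈ (l a).getD (j a) [], e' = e a :=
    fun hj => primrecPred_exists_mem (R := fun e' a => e' = e a) (hget hj)
      (Primrec.eq.comp fst (he.comp snd))
  have hagree : ∀ {p : α → ℕ}, Primrec p → PrimrecPred fun a =>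
      ∃ e' ∈ (l a).getD (k a / 7).unpair.2 [], Agree (n a) (L a) (p a) (e a) e' := fun {p} hp =>
    primrecPred_exists_mem (R := fun e' a => Agree (n a) (L a) (p a) (e a) e') (hget h₂)
      (primrecPred_agree (hn.comp snd) (hL.comp snd) (hp.comp snd) (he.comp snd) fst)
  exact ((hmod 0).and (Primrec.eq.comp (primrec_valN hn he h₁) (primrec_valN hn he h₂))).or <|
    ((hmod 1).and (primrecPred_inN hn he (primrec_affine 4 2 h₁) (primrec_valN hn he h₂))).or <|
    ((hmod 2).and (primrecPred_inN hn he (primrec_affine 4 1 h₂) (primrec_valN hn he h₁))).or <|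
    ((hmod 3).and (hmem h₀).not).or <|
    ((hmod 4).and ((hmem h₁).and (hmem h₂))).or <|
    ((hmod 5).and (hagree (primrec_affine 4 0 h₁))).or
    ((hmod 6).and (hagree (primrec_affine 4 1 h₁)))

end

theorem primrec_tab : Primrec₂ fun (p : ℕ × ℕ) (k : ℕ) => tab p.1 p.2 k := by
  classical
  have hR : PrimrecRel fun (e : ℕ) (x : (ℕ × ℕ) × List (List ℕ)) =>
      Cond x.1.1 x.1.2 (fun j => x.2.getD j []) x.2.length e :=
    primrecPred_cond (fst.comp (fst.comp snd)) (snd.comp (fst.comp snd))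
      (list_length.comp (snd.comp snd)) fst (snd.comp snd)
  have hrange : Primrec fun x : (ℕ × ℕ) × List (List ℕ) =>
      List.range ((2 ^ (x.1.1 + 1)) ^ x.1.2) :=
    list_range.comp (primrec_pow (primrec_base (fst.comp fst)) (snd.comp fst))
  -- the list of earlier values has length `k`, which tells the step function the current number
  refine nat_strong_rec _ (option_some.comp (hR.listFilter.comp hrange .id)).to₂ fun p k => ?_
  simp only [id, Option.some.injEq, List.length_map, List.length_range]
  rw [tab]
  congr 1
  funext e
  congr 2
  funext j
  by_cases h : j < k
  · simp [h, List.getD]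
  · simp [h, List.getD]

theorem primrec_modelBound {f g : ℕ → ℕ} (hf : Primrec f) (hg : Primrec g) :
    Primrec fun c => modelBound (f c) (g c) := by
  have hsq : ∀ {β : Type} [Primcodable β] {h : β → ℕ}, Primrec h →
      Primrec fun x => 2 ^ (7 * ((h x + 1) * (h x + 1))) := fun hh =>
    primrec_pow (.const 2) (nat_mul.comp (.const 7) (nat_mul.comp (succ.comp hh) (succ.comp hh)))
  have hT : Primrec₂ typeBound := by
    refine (nat_rec (f := fun u => 2 ^ (7 * ((u + 1) * (u + 1))))
      (g := fun u p => 2 ^ (7 * ((u + 1) * (u + 1))) * (2 ^ p.2) ^ 2 ^ u)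
      (hsq .id) ?_).of_eq fun u q => ?_
    · refine Primrec.to₂ (f := fun x : ℕ × ℕ × ℕ =>
        2 ^ (7 * ((x.1 + 1) * (x.1 + 1))) * (2 ^ x.2.2) ^ 2 ^ x.1) ?_
      exact nat_mul.comp (hsq fst) (primrec_pow (primrec_pow (.const 2) (snd.comp snd))
        (primrec_pow (.const 2) fst))
    · induction q with
      | zero => rfl
      | succ q ih => simp only [typeBound, ← ih]
  exact primrec_pow (.const 2) (hT.comp (nat_add.comp (nat_mul.comp hf hf) (nat_add.comp hf hf)) hg)

end MSOUnary

/-- The finite satisfiability problem for MSO formulas with one unary function symbol is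
decidable. -/
theorem mainTheorem2 :
    ComputablePred (fun φ : MSOUnary.Formula => φ.FinitelySatisfiable) := by
  have hR : PrimrecRel fun n c : ℕ => MSOUnary.tab n (4 * (c + n + 2)) c ≠ [] :=
    PrimrecPred.not <| Primrec.eq.comp (MSOUnary.primrec_tab.comp
      (Primrec.fst.pair (Primrec.nat_mul.comp (.const 4) (Primrec.nat_add.comp
        (Primrec.nat_add.comp .snd .fst) (.const 2)))) .snd) (.const [])
  have hP : PrimrecPred fun c : ℕ => ∃ n < MSOUnary.modelBound (c + 1) c,
      MSOUnary.tab n (4 * (c + n + 2)) c ≠ [] :=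
    hR.exists_lt.comp (MSOUnary.primrec_modelBound Primrec.succ .id) .id
  exact ((hP.comp Primrec.encode).of_eq fun φ =>
    (MSOUnary.finitelySatisfiable_iff_tab φ).symm).computablePred
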